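/- **Conventions.** Write $x^g=g^{-1}xg$. A group $G=\langle a,b,c\rangle$ is a *triangle-point group* if $a,b,c$ and $ab$ have order $2$ and, for all $t,s\in a^G\cup b^G\cup c^G\cup(ab)^G$, the product $ts$ has order at most $6$. Let $V$ be a real vector space with an inner product $(\,,)$ and a commutative bilinear product $\cdot$ (not necessarily associative). For $a\in V$ and $\mu\in\mathbb R$ let $V_\mu^{(a)}=\{v\in V: a\cdot v=\mu v\}$. An element $a\in V$ is a *Majorana axis* if - (M3) $(a,a)=1$ and $a\cdot a=a$; - (M4) $V=V_1^{(a)}\oplus V_0^{(a)}\oplus V_{1/4}^{(a)}\oplus V_{1/32}^{(a)}$; - (M5) $V_1^{(a)}=\mathbb R a$; - (M6) the linear map $\tau(a)$ of $V$ that is $1$ on $V_1^{(a)}\oplus V_0^{(a)}\oplus V_{1/4}^{(a)}$ and $-1$ on $V_{1/32}^{(a)}$ preserves the product; - (M7) the linear map $\sigma(a)$ of $V_+^{(a)}=V_1^{(a)}\oplus V_0^{(a)}\oplus V_{1/4}^{(a)}$ that is $1$ on $V_1^{(a)}\oplus V_0^{(a)}$ and $-1$ on $V_{1/4}^{(a)}$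 preserves the restriction of the product to $V_+^{(a)}$. For $a_0,a_1,a_\rho\in V$, the subalgebra $\langle\langle a_0,a_1\rangle\rangle$ generated by $a_0,a_1$ is *of type $2A$ with third axis $a_\rho$* if it has basis $a_0,a_1,a_\rho$, each basis vector is idempotent of length $1$, any two distinct basis vectors have inner product $\frac18$, and $x\cdot y=\frac18(x+y-z)$ whenever $\{x,y,z\}=\{a_0,a_1,a_\rho\}$. A *Majorana representation* of the form $(G,T,V)$ consists of a finite group $G$; a generating set $T$ of involutions of $G$ that is stable under conjugation; a real inner product space $V$ with a commutative bilinear product that satisfies (M1) $(u,v\cdot w)=(u\cdot v,w)$ and (M2) $(u\cdot u,v\cdot v)\ge(u\cdot v,u\cdot v)$ for all $u,v,w\in V$, and that is generated as an algebra by a set $A$ of Majorana axes; a linear representation $\varphi:G\to GL(V)$ that preserves both products; and a bijection $\psi:T\to A$ such that $\psi(t^g)=\psi(t)^{\varphi(g)}$ and $\varphi(t)=\tau(\psi(t))$ for all $t\in T$, $g\in G$, and such that axiom (M8) holds: for $t_0,t_1,t_2\in T$, if $\langle\langle\psi(t_0),\psi(t_1)\rangle\rangle$ is of type $2A$ with third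 axis $a_\rho$, then $t_0t_1\in T$ and $\psi(t_0t_1)=a_\rho$; and if $t_0t_1t_2=1$, then $\langle\langle\psi(t_0),\psi(t_1)\rangle\rangle$ is of type $2A$ with third axis $\psi(t_2)$. **Proposition.** Let $G=\langle a,b,c\rangle$ be a triangle-point group isomorphic to $2\times S_3\times S_3$, and let $T\subseteq G$ be a subset with $a,b,c,ab\in T$. 1. There is no Majorana representation of the form $(G,T,V)$. 2. For at least one $(r_1,r_2,r_3)\in\{(2,6,6),(6,2,6),(6,6,2)\}$, the group $G$ has, on the generators $a,b,c$, the presentation $$\langle a,b,c\mid a^2,b^2,c^2,(ab)^2,(ac)^6,(bc)^6,(abc)^6,(a\cdot b^c)^{r_1},(ab\cdot b^c)^{r_2},(ab\cdot a^c)^{r_3}\rangle .$$ 3. Put $K=\langle a,b,(abc)^3\rangle$, $K=\langle a,b,(ac)^3\rangle$ or $K=\langle a,b,(bc)^3\rangle$ if this presentation holds with $(r_1,r_2,r_3)=(2,6,6)$, $(6,2,6)$ or $(6,6,2)$, respectively. Then $K\cong 2^3$. If, moreover, $T$ is stable under conjugation in $G$ and contains $(ts)^3$ for all $t,s\in T$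 such that $ts$ has order $6$, then every non-identity element of $K$ lies in $T$. -/

import Mathlib

namespace Majorana

section Algebra

variable {V : Type*} [NormedAddCommGroup V] [InnerProductSpace ℝ V]

/-- `V_μ^{(a)} = {v | a · v = μ v}`, for the bilinear product `mul` on `V`. -/
def eig (mul : V →ₗ[ℝ] V →ₗ[ℝ] V) (a : V) (μ : ℝ) : Submodule ℝ V :=
  Module.End.eigenspace (mul a) μ

/-- The smallest subalgebra of `(V, mul)` that contains `S`. -/
def subalgebraClosure (mul : V →ₗ[ℝ] V →ₗ[ℝ] V) (S : Set V) : Submodule ℝ V :=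
  sInf {W : Submodule ℝ V | S ⊆ W ∧ ∀ u ∈ W, ∀ v ∈ W, mul u v ∈ W}

/-- `τ` is the linear map `τ(a)` that acts on `V_μ^{(a)}` as `(-1)^(2^5 μ)`, for
`μ = 1, 0, 1/4, 1/32`. As `V` is the direct sum of these eigenspaces when `a` is a Majorana axis,
`τ` is then determined by `a`. -/
structure IsTau (mul : V →ₗ[ℝ] V →ₗ[ℝ] V) (a : V) (τ : V →ₗ[ℝ] V) : Prop where
  one : ∀ u ∈ eig mul a 1, τ u = u
  zero : ∀ u ∈ eig mul a 0, τ u = u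
  quarter : ∀ u ∈ eig mul a (1 / 4), τ u = u
  thirtySecond : ∀ u ∈ eig mul a (1 / 32), τ u = -u

/-- `V_+^{(a)} = V_1^{(a)} ⊕ V_0^{(a)} ⊕ V_{1/4}^{(a)}`. -/
noncomputable def plusPart (mul : V →ₗ[ℝ] V →ₗ[ℝ] V) (a : V) : Submodule ℝ V :=
  eig mul a 1 ⊔ eig mul a 0 ⊔ eig mul a (1 / 4)

/-- `σ` is the linear map `σ(a)` of `V_+^{(a)}` that acts on `V_μ^{(a)}` as `(-1)^(2^2 μ)`, for
`μ = 1, 0, 1/4`. -/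
structure IsSigma (mul : V →ₗ[ℝ] V →ₗ[ℝ] V) (a : V)
    (σ : plusPart mul a →ₗ[ℝ] plusPart mul a) : Prop where
  one : ∀ u : plusPart mul a, (u : V) ∈ eig mul a 1 → σ u = u
  zero : ∀ u : plusPart mul a, (u : V) ∈ eig mul a 0 → σ u = u
  quarter : ∀ u : plusPart mul a, (u : V) ∈ eig mul a (1 / 4) → σ u = -u

/-- Axioms (M3) to (M7) for `a`. -/
structure IsMajoranaAxis (mul : V →ₗ[ℝ] V →ₗ[ℝ] V) (a : V) : Prop where
  /-- (M3), first part -/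
  inner_self : inner ℝ a a = 1
  /-- (M3), second part -/
  idempotent : mul a a = a
  /-- (M4) -/
  decomposition :
    DirectSum.IsInternal (fun i : Fin 4 => eig mul a ((![1, 0, 1 / 4, 1 / 32] : Fin 4 → ℝ) i))
  /-- (M5) -/
  eig_one : eig mul a 1 = Submodule.span ℝ {a}
  /-- (M6) -/
  tau_mul : ∃ τ : V →ₗ[ℝ] V, IsTau mul a τ ∧ ∀ u v : V, τ (mul u v) = mul (τ u) (τ v)
  /-- (M7) -/
  sigma_mul : ∃ σ : plusPart mul a →ₗ[ℝ] plusPart mul a, IsSigma mul a σ ∧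
    ∀ u v : plusPart mul a, ∃ w : plusPart mul a,
      (w : V) = mul (u : V) (v : V) ∧ (σ w : V) = mul (σ u : V) (σ v : V)

/-- `V` with the product `mul` is a real commutative algebra that satisfies (M1) and (M2) and is
generated by the set `A` of Majorana axes. -/
structure IsMajoranaAlgebra (mul : V →ₗ[ℝ] V →ₗ[ℝ] V) (A : Set V) : Prop where
  comm : ∀ u v : V, mul u v = mul v u
  /-- (M1) -/
  assoc : ∀ u v w : V, inner ℝ u (mul v w) = inner ℝ (mul u v) w
  /-- (M2), the Norton inequality -/
  norton : ∀ u v : V, inner ℝ (mul u v) (mul u v) ≤ inner ℝ (mul u u) (mul v v)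
  axis : ∀ a ∈ A, IsMajoranaAxis mul a
  generated : subalgebraClosure mul A = ⊤

/-- The subalgebra generated by `a₀` and `a₁` is a dihedral algebra of type `2A`, with `r` as the
third basis vector `a_ρ`: it has the basis `a₀, a₁, r` with the multiplication and the Gram matrix
of the algebra of type `2A`. -/
structure IsType2A (mul : V →ₗ[ℝ] V →ₗ[ℝ] V) (a₀ a₁ r : V) : Prop where
  linearIndependent : LinearIndependent ℝ ![a₀, a₁, r]
  span_eq : Submodule.span ℝ {a₀, a₁, r} = subalgebraClosure mul {a₀, a₁}
  mul_00 : mul a₀ a₀ = a₀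
  mul_11 : mul a₁ a₁ = a₁
  mul_rr : mul r r = r
  mul_01 : mul a₀ a₁ = (1 / 8 : ℝ) • (a₀ + a₁ - r)
  mul_0r : mul a₀ r = (1 / 8 : ℝ) • (a₀ + r - a₁)
  mul_1r : mul a₁ r = (1 / 8 : ℝ) • (a₁ + r - a₀)
  inner_00 : inner ℝ a₀ a₀ = 1
  inner_11 : inner ℝ a₁ a₁ = 1
  inner_rr : inner ℝ r r = 1
  inner_01 : inner ℝ a₀ a₁ = 1 / 8
  inner_0r : inner ℝ a₀ r = 1 / 8
  inner_1r : inner ℝ a₁ r = 1 / 8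

end Algebra

/-- A Majorana representation `(G, T, V, ·, (,), φ, ψ)` that satisfies axiom (M8). The inner
product is that of `V`. The map `ψ` is used on `T` only. Linear maps are written on the left, so
that `ψ(t^g) = ψ(t)^φ(g)` reads `ψ (g * t * g⁻¹) = φ g (ψ t)`. -/
structure MajoranaRepresentation (G : Type*) [Group G] (T : Set G)
    (V : Type*) [NormedAddCommGroup V] [InnerProductSpace ℝ V] where
  finite : Finite G
  involution : ∀ t ∈ T, orderOf t = 2
  conj_mem : ∀ t ∈ T, ∀ g : G, g * t * g⁻¹ ∈ T
  closure_eq : Subgroup.closure T = ⊤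
  mul : V →ₗ[ℝ] V →ₗ[ℝ] V
  /-- the set of Majorana axes that generates `V` -/
  A : Set V
  isMajoranaAlgebra : IsMajoranaAlgebra mul A
  φ : Representation ℝ G V
  φ_mul : ∀ (g : G) (u v : V), φ g (mul u v) = mul (φ g u) (φ g v)
  φ_inner : ∀ (g : G) (u v : V), inner ℝ (φ g u) (φ g v) = inner ℝ u v
  ψ : G → V
  ψ_bij : Set.BijOn ψ T A
  ψ_conj : ∀ t ∈ T, ∀ g : G, ψ (g * t * g⁻¹) = φ g (ψ t)
  /-- `φ(t)` is the Majorana involution `τ(ψ(t))`. -/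
  φ_eq_tau : ∀ t ∈ T, IsTau mul (ψ t) (φ t)
  /-- (M8), first part -/
  mem_of_type2A : ∀ t₀ ∈ T, ∀ t₁ ∈ T, ∀ r : V, IsType2A mul (ψ t₀) (ψ t₁) r →
    t₀ * t₁ ∈ T ∧ ψ (t₀ * t₁) = r
  /-- (M8), second part -/
  type2A_of_mul_eq_one : ∀ t₀ ∈ T, ∀ t₁ ∈ T, ∀ t₂ ∈ T, t₀ * t₁ * t₂ = 1 →
    IsType2A mul (ψ t₀) (ψ t₁) (ψ t₂)

section Groups

variable {G : Type*} [Group G]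

/-- `x^g = g⁻¹ x g` -/
def cj (x g : G) : G := g⁻¹ * x * g

/-- `G = ⟨a, b, c⟩` is a triangle-point group. -/
structure IsTrianglePoint (a b c : G) : Prop where
  closure_eq : Subgroup.closure {a, b, c} = ⊤
  orderOf_a : orderOf a = 2
  orderOf_b : orderOf b = 2
  orderOf_c : orderOf c = 2
  orderOf_ab : orderOf (a * b) = 2
  orderOf_mul : ∀ t ∈ Group.conjugatesOfSet {a, b, c, a * b},
    ∀ s ∈ Group.conjugatesOfSet {a, b, c, a * b}, 0 < orderOf (t * s) ∧ orderOf (t * s) ≤ 6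

/-- The elements `a², b², c², (ab)², (ac)⁶, (bc)⁶, (abc)⁶, (a·b^c)^r₁, (ab·b^c)^r₂, (ab·a^c)^r₃`. -/
def relators (a b c : G) (r₁ r₂ r₃ : ℕ) : Set G :=
  {a ^ 2, b ^ 2, c ^ 2, (a * b) ^ 2, (a * c) ^ 6, (b * c) ^ 6, (a * b * c) ^ 6,
    (a * cj b c) ^ r₁, (a * b * cj b c) ^ r₂, (a * b * cj a c) ^ r₃}

/-- `G = ⟨a, b, c | relators a b c r₁ r₂ r₃⟩`: the elements `a, b, c` generate `G` and the kernel of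
the map from the free group is the normal closure of the relators. -/
def HasPresentation (a b c : G) (r₁ r₂ r₃ : ℕ) : Prop :=
  Subgroup.closure {a, b, c} = ⊤ ∧
    (FreeGroup.lift (![a, b, c] : Fin 3 → G)).ker =
      Subgroup.normalClosure
        (relators (FreeGroup.of (0 : Fin 3)) (FreeGroup.of 1) (FreeGroup.of 2) r₁ r₂ r₃)

/-- `K` is isomorphic to the elementary abelian group `2³`. -/
def IsElementaryAbelian8 (K : Subgroup G) : Prop :=
  Nonempty (K ≃* Multiplicative (Fin 3 → ZMod 2))

/-- `T` is a `G`-stable subset of `G` that contains `(ts)³` whenever `t, s ∈ T` and `ts` has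
order `6`. -/
structure IsCubeClosed (T : Set G) : Prop where
  conj_mem : ∀ t ∈ T, ∀ g : G, g * t * g⁻¹ ∈ T
  cube_mem : ∀ t ∈ T, ∀ s ∈ T, orderOf (t * s) = 6 → (t * s) ^ 3 ∈ T

end Groups

end Majorana

/-! Group side. Each projection of `G` onto an `S₃` factor sends `c` to a transposition and kills
exactly one of `a`, `b`, `ab`, because commuting elements of order at most 2 in `S₃` lie in a common
subgroup of order at most 2. The two projections kill different ones, since otherwise their sign
characters would agree on the generators. If `p` and `q` are the two killed elements, then `p`
commutes with `q^c`, and this is the relator of exponent 2. Conversely, such relations make a group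
equal to ⟨p, p^c⟩⟨q, q^c⟩⟨c⟩, where the first two factors have order at most 6 and the last at most
2. So the presented group has order at most 72 = |G|, and the presentation holds (`exists_relation`,
`IsSplitTriple.card_le`, `hasPresentation_of_card_le`).

In these terms K = ⟨p, q, (pqc)³⟩. Uniqueness of the normal form xy or xyc gives K ≅ 2³. Outside ⟨p,
q⟩ its elements are the cube (pqc)³, conjugates of (qc)³ and (pc)³, and a conjugate of `c`, so a
cube-closed `T` contains all of them (`mem_of_isCubeClosed`).

Algebra side. The fusion rules yield two cases of the Norton–Sakuma theorem. Commuting axes are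
orthogonal with product zero or generate an algebra of type 2A. If `ts` has order 6, the two
opposite reflections of the hexagon cannot have product zero. By (M8), `T` is therefore cube-closed
(`isCubeClosed`), and so contains the involutions of K. But axes for all seven involutions of a 2³
contradict the fusion rule for 1/4-eigenvectors (`eq_of_pure_rank_three`). -/

namespace Majorana

/-! ### Fusion rules for a single Majorana axis. -/

section Algebra

variable {V : Type*} [NormedAddCommGroup V] [InnerProductSpace ℝ V]
  {mul : V →ₗ[ℝ] V →ₗ[ℝ] V} {a : V}

theorem mem_eig_iff {μ : ℝ} {v : V} : v ∈ eig mul a μ ↔ mul a v = μ • v :=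
  Module.End.mem_eigenspace_iff

namespace IsMajoranaAxis

theorem exists_decomposition (h : IsMajoranaAxis mul a) (v : V) :
    ∃ c : ℝ, ∃ u w z : V, mul a u = 0 ∧ mul a w = (1 / 4 : ℝ) • w ∧
      mul a z = (1 / 32 : ℝ) • z ∧ v = c • a + u + w + z := by
  obtain ⟨d, hd⟩ := h.decomposition.surjective v
  classical
  rw [DirectSum.coeAddMonoidHom_eq_dfinsuppSum, DFinsupp.sum_eq_sum_fintype _ (by simp)] at hd
  simp only [Fin.sum_univ_four] at hd
  have h1 : (d 0 : V) ∈ eig mul a 1 := (d 0).2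
  rw [h.eig_one] at h1
  obtain ⟨c, hc⟩ := Submodule.mem_span_singleton.1 h1
  refine ⟨c, d 1, d 2, d 3, ?_, ?_, ?_, ?_⟩
  · have := mem_eig_iff.1 (d 1).2
    simpa using this
  · exact mem_eig_iff.1 (d 2).2
  · exact mem_eig_iff.1 (d 3).2
  · rw [← hd, hc]; rfl

theorem mem_plusPart_iff (h : IsMajoranaAxis mul a) {v : V} :
    v ∈ plusPart mul a ↔ ∃ c : ℝ, ∃ u w : V, mul a u = 0 ∧ mul a w = (1 / 4 : ℝ) • w ∧
      v = c • a + u + w := by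
  constructor
  · intro hv
    obtain ⟨y, hy, w, hw, rfl⟩ := Submodule.mem_sup.1 hv
    obtain ⟨x, hx, u, hu, rfl⟩ := Submodule.mem_sup.1 hy
    rw [h.eig_one] at hx
    obtain ⟨c, rfl⟩ := Submodule.mem_span_singleton.1 hx
    exact ⟨c, u, w, by simpa using mem_eig_iff.1 hu, mem_eig_iff.1 hw, rfl⟩
  · rintro ⟨c, u, w, hu, hw, rfl⟩
    refine Submodule.add_mem_sup (Submodule.add_mem_sup ?_ ?_) (mem_eig_iff.2 hw)
    · rw [h.eig_one]; exact Submodule.mem_span_singleton.2 ⟨c, rfl⟩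
    · exact mem_eig_iff.2 (by simpa using hu)

/-- This lemma and `mul_eq_of_tau_eq_neg` turn the action of τ(a) into information on products: a
fixed vector has no 1/32-component, and a negated vector has no other component. -/
theorem mem_plusPart_of_fixed (h : IsMajoranaAxis mul a) {τ : V →ₗ[ℝ] V} (hτ : IsTau mul a τ)
    {v : V} (hv : τ v = v) : v ∈ plusPart mul a := by
  obtain ⟨c, u, w, z, hu, hw, hz, rfl⟩ := h.exists_decomposition v
  have e1 : τ a = a := hτ.one a (mem_eig_iff.2 (by simpa using h.idempotent))
  have e2 : τ u = u := hτ.zero u (mem_eig_iff.2 (by simpa using hu))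
  have e3 : τ w = w := hτ.quarter w (mem_eig_iff.2 hw)
  have e4 : τ z = -z := hτ.thirtySecond z (mem_eig_iff.2 hz)
  simp only [map_add, map_smul, e1, e2, e3, e4] at hv
  have hz0 : z = 0 := by
    have : (2 : ℝ) • z = 0 := by linear_combination (norm := module) -hv
    simpa using this
  exact h.mem_plusPart_iff.2 ⟨c, u, w, hu, hw, by rw [hz0, add_zero]⟩

theorem mul_eq_of_tau_eq_neg (h : IsMajoranaAxis mul a) {τ : V →ₗ[ℝ] V} (hτ : IsTau mul a τ)
    {v : V} (hv : τ v = -v) : mul a v = (1 / 32 : ℝ) • v := by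
  obtain ⟨c, u, w, z, hu, hw, hz, rfl⟩ := h.exists_decomposition v
  have e1 : τ a = a := hτ.one a (mem_eig_iff.2 (by simpa using h.idempotent))
  have e2 : τ u = u := hτ.zero u (mem_eig_iff.2 (by simpa using hu))
  have e3 : τ w = w := hτ.quarter w (mem_eig_iff.2 hw)
  have e4 : τ z = -z := hτ.thirtySecond z (mem_eig_iff.2 hz)
  simp only [map_add, map_smul, e1, e2, e3, e4] at hv
  have h0 : c • a + u + w = 0 := by
    have : (2 : ℝ) • (c • a + u + w) = 0 := by linear_combination (norm := module) hv
    simpa only [smul_eq_zero, OfNat.ofNat_ne_zero, false_or] using this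
  rw [h0, zero_add, hz]

variable {A : Set V}

theorem inner_eq_zero (h : IsMajoranaAxis mul a) (hV : IsMajoranaAlgebra mul A) {u : V} {μ : ℝ}
    (hμ : μ ≠ 1) (hu : mul a u = μ • u) : inner ℝ a u = 0 := by
  have := hV.assoc a a u
  rw [h.idempotent, hu, inner_smul_right] at this
  have h2 : (μ - 1) * inner ℝ a u = 0 := by linear_combination this
  exact (mul_eq_zero.1 h2).resolve_left (sub_ne_zero.2 hμ)

/-- The action of `σ(a)` on the eigenvectors, and its compatibility with the product. -/
theorem exists_sigma_decomposition (h : IsMajoranaAxis mul a) {u v : V} {ε δ : ℝ}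
    (hu : mul a u = 0 ∧ ε = 1 ∨ mul a u = (1 / 4 : ℝ) • u ∧ ε = -1)
    (hv : mul a v = 0 ∧ δ = 1 ∨ mul a v = (1 / 4 : ℝ) • v ∧ δ = -1) :
    ∃ c : ℝ, ∃ x w : V, mul a x = 0 ∧ mul a w = (1 / 4 : ℝ) • w ∧
      mul u v = c • a + x + w ∧ (ε * δ) • mul u v = c • a + x - w := by
  obtain ⟨σ, hσ, hmul⟩ := h.sigma_mul
  have key : ∀ {u : V} {ε : ℝ}, (mul a u = 0 ∧ ε = 1 ∨ mul a u = (1 / 4 : ℝ) • u ∧ ε = -1) →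
      ∃ hu : u ∈ plusPart mul a, (σ ⟨u, hu⟩ : V) = ε • u := by
    rintro u ε (⟨hu, rfl⟩ | ⟨hu, rfl⟩)
    · have hm : u ∈ eig mul a 0 := mem_eig_iff.2 (by simpa using hu)
      have hm' : u ∈ plusPart mul a := Submodule.mem_sup_left (Submodule.mem_sup_right hm)
      refine ⟨hm', ?_⟩
      rw [hσ.zero ⟨u, _⟩ hm, one_smul]
    · have hm : u ∈ eig mul a (1 / 4) := mem_eig_iff.2 hu
      have hm' : u ∈ plusPart mul a := Submodule.mem_sup_right hm
      refine ⟨hm', ?_⟩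
      rw [hσ.quarter ⟨u, _⟩ hm, neg_one_smul, Submodule.coe_neg]
  obtain ⟨hu', eu⟩ := key hu
  obtain ⟨hv', ev⟩ := key hv
  obtain ⟨p, hp, hσp⟩ := hmul ⟨u, hu'⟩ ⟨v, hv'⟩
  obtain ⟨c, x, w, hx, hw, he⟩ := h.mem_plusPart_iff.1 p.2
  refine ⟨c, x, w, hx, hw, by rw [← he, hp], ?_⟩
  obtain ⟨hx', ex⟩ := key (u := x) (ε := 1) (Or.inl ⟨hx, rfl⟩)
  obtain ⟨hw', ew⟩ := key (u := w) (ε := -1) (Or.inr ⟨hw, rfl⟩)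
  have hma : a ∈ eig mul a 1 := mem_eig_iff.2 (by simpa using h.idempotent)
  have ha' : a ∈ plusPart mul a := Submodule.mem_sup_left (Submodule.mem_sup_left hma)
  have ea := hσ.one ⟨a, ha'⟩ hma
  have hpe : p = c • ⟨a, ha'⟩ + ⟨x, hx'⟩ + ⟨w, hw'⟩ := Subtype.ext he
  rw [hpe, map_add, map_add, map_smul, ea, eu, ev] at hσp
  simp only [Submodule.coe_add, Submodule.coe_smul, ex, ew, map_smul, LinearMap.smul_apply]
    at hσp
  linear_combination (norm := module) -hσp

/-- σ(a) negates the product of an even and an odd vector, so only its 1/4-component survives. -/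
theorem mul_zero_quarter (h : IsMajoranaAxis mul a) {u v : V} (hu : mul a u = 0)
    (hv : mul a v = (1 / 4 : ℝ) • v) : mul a (mul u v) = (1 / 4 : ℝ) • mul u v := by
  obtain ⟨c, x, w, -, hw, e1, e2⟩ :=
    h.exists_sigma_decomposition (Or.inl ⟨hu, rfl⟩) (Or.inr ⟨hv, rfl⟩)
  have : mul u v = w := by linear_combination (norm := module) (1 / 2 : ℝ) • (e1 - e2)
  rw [this, hw]

/-- The product of two odd vectors is even, so it is c·a plus a 0-eigenvector. Associativity of the
form gives c = (a, uv) = (au, v) = (u, v)/4. -/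
theorem mul_quarter_quarter (h : IsMajoranaAxis mul a) (hV : IsMajoranaAlgebra mul A) {u v : V}
    (hu : mul a u = (1 / 4 : ℝ) • u) (hv : mul a v = (1 / 4 : ℝ) • v) :
    mul a (mul u v) = ((1 / 4 : ℝ) * inner ℝ u v) • a := by
  obtain ⟨c, x, w, hx, -, e1, e2⟩ :=
    h.exists_sigma_decomposition (Or.inr ⟨hu, rfl⟩) (Or.inr ⟨hv, rfl⟩)
  have e : mul u v = c • a + x := by linear_combination (norm := module) (1 / 2 : ℝ) • (e1 + e2)
  have hin := hV.assoc a u v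
  rw [e, hu, inner_add_right, inner_smul_right, inner_smul_left, h.inner_self,
    h.inner_eq_zero hV zero_ne_one (by simpa using hx)] at hin
  simp only [conj_trivial] at hin
  rw [e, map_add, map_smul, h.idempotent, hx, add_zero]
  congr 1
  linear_combination hin

/-- The polynomial X² − X/4 vanishes at the eigenvalues 0 and 1/4 and equals 3/4 at 1; the component
of `y` along `a` is (a, y)a. -/
theorem mul_mul_of_mem_plusPart (h : IsMajoranaAxis mul a) (hV : IsMajoranaAlgebra mul A) {y : V}
    (hy : y ∈ plusPart mul a) :
    mul a (mul a y) = (1 / 4 : ℝ) • mul a y + (3 / 4 * inner ℝ a y : ℝ) • a := by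
  obtain ⟨c, u, w, hu, hw, rfl⟩ := h.mem_plusPart_iff.1 hy
  have e1 := h.inner_eq_zero hV zero_ne_one (u := u) (by simpa using hu)
  have e2 := h.inner_eq_zero hV (by norm_num) hw
  simp only [inner_add_right, inner_smul_right, e1, e2, h.inner_self, map_add, map_smul, hu, hw,
    h.idempotent, map_zero]
  module

theorem mul_zero_zero (h : IsMajoranaAxis mul a) (hV : IsMajoranaAlgebra mul A) {u v : V}
    (hu : mul a u = 0) (hv : mul a v = 0) : mul a (mul u v) = 0 := by
  obtain ⟨c, x, w, hx, -, e1, e2⟩ :=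
    h.exists_sigma_decomposition (Or.inl ⟨hu, rfl⟩) (Or.inl ⟨hv, rfl⟩)
  have e : mul u v = c • a + x := by linear_combination (norm := module) (1 / 2 : ℝ) • (e1 + e2)
  have hin := hV.assoc a u v
  rw [e, hu, inner_add_right, inner_smul_right, inner_zero_left, h.inner_self,
    h.inner_eq_zero hV zero_ne_one (by simpa using hx)] at hin
  have : c = 0 := by linear_combination hin
  rw [e, map_add, map_smul, hx, this, zero_smul, add_zero]

/-- Seress: `a` associates with its `0`-eigenvectors on `V_+`. -/
theorem mul_comm_of_mul_eq_zero (h : IsMajoranaAxis mul a) (hV : IsMajoranaAlgebra mul A) {x y : V}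
    (hx : mul a x = 0) (hy : y ∈ plusPart mul a) :
    mul a (mul x y) = mul x (mul a y) := by
  obtain ⟨c, u, w, hu, hw, rfl⟩ := h.mem_plusPart_iff.1 hy
  simp only [map_add, map_smul, hu, hw, h.idempotent, hV.comm x a, hx, h.mul_zero_quarter hx hw,
    map_zero, h.mul_zero_zero hV hx hu]

/-- The resurrection identity: the square of the `1/4`-part of `y` in terms of products of `y`
with that part. -/
theorem mul_quarterPart_self (h : IsMajoranaAxis mul a) (hV : IsMajoranaAlgebra mul A) {y w q : V}
    (hy : y ∈ plusPart mul a) (hw : w = y - (inner ℝ a y : ℝ) • a)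
    (hq : q = mul a y - (inner ℝ a y : ℝ) • a) :
    (4 : ℝ) • mul q q = mul w q - (4 : ℝ) • mul a (mul w q) + (inner ℝ w q : ℝ) • a := by
  obtain ⟨c, u, v, hu, hv, rfl⟩ := h.mem_plusPart_iff.1 hy
  have e1 := h.inner_eq_zero hV zero_ne_one (u := u) (by simpa using hu)
  have e2 := h.inner_eq_zero hV (by norm_num) hv
  have hin : inner ℝ a (c • a + u + v) = c := by
    simp only [inner_add_right, inner_smul_right, e1, e2, h.inner_self]; ring
  have hq' : q = (1 / 4 : ℝ) • v := by
    rw [hq, hin]; simp only [map_add, map_smul, h.idempotent, hu, hv]; module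
  have hw' : w = u + v := by rw [hw, hin]; module
  have huv : inner ℝ u v = (0 : ℝ) := by
    have := hV.assoc u a v
    rw [hV.comm u a, hu, hv, inner_smul_right, inner_zero_left] at this
    linarith
  have f1 := h.mul_zero_quarter hu hv
  have f2 := h.mul_quarter_quarter hV hv hv
  -- Here w·q = (uv + vv)/4. As uv is a 1/4-eigenvector, subtracting 4a(w·q) removes it and leaves
  -- vv/4 up to a multiple of `a`.
  rw [hq', hw']
  simp only [map_add, map_smul, LinearMap.add_apply, LinearMap.smul_apply, f1, f2,
    inner_add_left, inner_smul_right, huv]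
  module

end IsMajoranaAxis

end Algebra

/-! ### Algebras generated by two axes, and elementary abelian configurations. -/

section Dihedral

variable {V : Type*} [NormedAddCommGroup V] [InnerProductSpace ℝ V]
  {mul : V →ₗ[ℝ] V →ₗ[ℝ] V} {A : Set V}

namespace IsMajoranaAxis

/-- The square of `a₀ · a₁`, when `τ(a₀)` fixes `a₁` and `τ(a₁)` fixes `a₀`. -/
theorem mul_mul_self_of_mem_plusPart {a₀ a₁ p : V} {l : ℝ} (h₀ : IsMajoranaAxis mul a₀)
    (h₁ : IsMajoranaAxis mul a₁) (hV : IsMajoranaAlgebra mul A) (h₀₁ : a₁ ∈ plusPart mul a₀)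
    (h₁₀ : a₀ ∈ plusPart mul a₁) (hp : mul a₀ a₁ = p) (hl : inner ℝ a₀ a₁ = l) :
    mul p p = (l / 16 + l ^ 2) • a₀ + (3 / 16 * l) • a₁ - (l / 4) • p := by
  have hp' : mul a₁ a₀ = p := by rw [hV.comm, hp]
  have hl' : inner ℝ a₁ a₀ = l := by rw [real_inner_comm, hl]
  have e0 := h₀.mul_mul_of_mem_plusPart hV h₀₁
  have e1 := h₁.mul_mul_of_mem_plusPart hV h₁₀
  rw [hp, hl] at e0
  rw [hp', hl'] at e1
  have e0' : mul p a₀ = _ := (hV.comm p a₀).trans e0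
  have i0 : inner ℝ a₀ p = l := by
    have := hV.assoc a₀ a₀ a₁
    rwa [hp, h₀.idempotent, hl] at this
  have i1 : inner ℝ a₁ p = l := by
    have := hV.assoc a₁ a₁ a₀
    rwa [hp', h₁.idempotent, hl'] at this
  have R := h₀.mul_quarterPart_self hV h₀₁ rfl rfl
  simp only [hl, hp, hp', map_sub, map_add, map_smul, LinearMap.sub_apply, LinearMap.smul_apply,
    e0, e1, e0', h₀.idempotent, inner_sub_left, inner_sub_right, inner_smul_left, inner_smul_right,
    i0, i1, hl', h₀.inner_self, conj_trivial] at R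
  linear_combination (norm := module) (1 / 4 : ℝ) • R

/-- The formula for the square of a₀·a₁ is not symmetric in a₀ and a₁. Exchanging them and
subtracting gives l(l − 1/8)(a₀ − a₁) = 0. -/
theorem inner_mul_of_mem_plusPart {a₀ a₁ : V} (h₀ : IsMajoranaAxis mul a₀)
    (h₁ : IsMajoranaAxis mul a₁) (hV : IsMajoranaAlgebra mul A) (h₀₁ : a₁ ∈ plusPart mul a₀)
    (h₁₀ : a₀ ∈ plusPart mul a₁) (hne : a₀ ≠ a₁) :
    inner ℝ a₀ a₁ = (0 : ℝ) ∨ inner ℝ a₀ a₁ = (1 / 8 : ℝ) := by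
  have R0 := h₀.mul_mul_self_of_mem_plusPart h₁ hV h₀₁ h₁₀ rfl rfl
  have R1 := h₁.mul_mul_self_of_mem_plusPart h₀ hV h₁₀ h₀₁ (hV.comm a₁ a₀) (real_inner_comm _ _)
  have h : (inner ℝ a₀ a₁ * (inner ℝ a₀ a₁ - 1 / 8) : ℝ) • (a₀ - a₁) = 0 := by
    linear_combination (norm := module) R1 - R0
  rcases smul_eq_zero.1 h with h | h
  · rcases mul_eq_zero.1 h with h | h
    · exact Or.inl h
    · exact Or.inr (sub_eq_zero.1 h)
  · exact absurd (sub_eq_zero.1 h) hne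

/-- The squared length of a₀·a₁ is (a₁, a₀(a₀a₁)) = (a₁, a₀a₁)/4 = (a₁a₁, a₀)/4 = 0, and the form is
definite. -/
theorem mul_eq_zero_of_inner_eq_zero {a₀ a₁ : V} (h₀ : IsMajoranaAxis mul a₀)
    (h₁ : IsMajoranaAxis mul a₁) (hV : IsMajoranaAlgebra mul A) (h₀₁ : a₁ ∈ plusPart mul a₀)
    (hl : inner ℝ a₀ a₁ = (0 : ℝ)) : mul a₀ a₁ = 0 := by
  have e0 := h₀.mul_mul_of_mem_plusPart hV h₀₁
  have i1 : inner ℝ a₁ (mul a₀ a₁) = (0 : ℝ) := by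
    rw [hV.comm, hV.assoc, h₁.idempotent, real_inner_comm, hl]
  rw [hl] at e0
  have := hV.assoc a₁ a₀ (mul a₀ a₁)
  rw [e0, hV.comm a₁ a₀, inner_add_right, inner_smul_right, i1, inner_smul_right] at this
  exact (inner_self_eq_zero (𝕜 := ℝ)).1 (by linear_combination -this)

theorem isType2A_of_relations {a₀ a₁ r : V} (h₀ : IsMajoranaAxis mul a₀)
    (h₁ : IsMajoranaAxis mul a₁) (hV : IsMajoranaAlgebra mul A)
    (m₀₁ : mul a₀ a₁ = (1 / 8 : ℝ) • (a₀ + a₁ - r)) (m₀r : mul a₀ r = (1 / 8 : ℝ) • (a₀ + r - a₁))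
    (m₁r : mul a₁ r = (1 / 8 : ℝ) • (a₁ + r - a₀)) (mrr : mul r r = r)
    (i₀₁ : inner ℝ a₀ a₁ = (1 / 8 : ℝ)) (irr : inner ℝ r r = (1 : ℝ))
    (i₀r : inner ℝ a₀ r = (1 / 8 : ℝ)) (i₁r : inner ℝ a₁ r = (1 / 8 : ℝ)) :
    IsType2A mul a₀ a₁ r where
  linearIndependent := by
    have i₁₀ : inner ℝ a₁ a₀ = (1 / 8 : ℝ) := by rw [real_inner_comm, i₀₁]
    have ir₀ : inner ℝ r a₀ = (1 / 8 : ℝ) := by rw [real_inner_comm, i₀r]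
    have ir₁ : inner ℝ r a₁ = (1 / 8 : ℝ) := by rw [real_inner_comm, i₁r]
    rw [Fintype.linearIndependent_iff]
    intro g hg
    simp only [Fin.sum_univ_three, Matrix.cons_val_zero, Matrix.cons_val_one,
      Matrix.cons_val] at hg
    have g0 := congrArg (inner ℝ a₀) hg
    have g1 := congrArg (inner ℝ a₁) hg
    have g2 := congrArg (inner ℝ r) hg
    simp only [inner_add_right, inner_smul_right, inner_zero_right, h₀.inner_self, h₁.inner_self,
      i₀₁, i₁₀, i₀r, i₁r, ir₀, ir₁, irr] at g0 g1 g2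
    intro i
    fin_cases i
    · show g 0 = 0
      linarith
    · show g 1 = 0
      linarith
    · show g 2 = 0
      linarith
  span_eq := by
    apply le_antisymm
    · refine le_sInf fun W hW => Submodule.span_le.2 ?_
      obtain ⟨hS, hm⟩ := hW
      have w0 : a₀ ∈ W := hS (by simp)
      have w1 : a₁ ∈ W := hS (by simp)
      have hr : r = a₀ + a₁ - (8 : ℝ) • mul a₀ a₁ := by rw [m₀₁]; module
      rintro x (rfl | rfl | rfl)
      · exact w0
      · exact w1
      · rw [hr]
        exact W.sub_mem (W.add_mem w0 w1) (W.smul_mem _ (hm _ w0 _ w1))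
    · refine sInf_le ⟨fun x hx => Submodule.subset_span ?_, fun u hu v hv => ?_⟩
      · rcases hx with rfl | rfl <;> simp
      · have hmem := Submodule.apply_mem_map₂ mul hu hv
        rw [Submodule.map₂_span_span] at hmem
        refine Submodule.span_le.2 ?_ hmem
        set W := Submodule.span ℝ {a₀, a₁, r}
        have w0 : a₀ ∈ W := Submodule.subset_span (by simp)
        have w1 : a₁ ∈ W := Submodule.subset_span (by simp)
        have wr : r ∈ W := Submodule.subset_span (by simp)
        have key : ∀ {x y z : V}, x ∈ W → y ∈ W → z ∈ W → (1 / 8 : ℝ) • (x + y - z) ∈ W :=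
          fun hx hy hz => W.smul_mem _ (W.sub_mem (W.add_mem hx hy) hz)
        have m₁₀ := (hV.comm a₁ a₀).trans m₀₁
        have mr₀ := (hV.comm r a₀).trans m₀r
        have mr₁ := (hV.comm r a₁).trans m₁r
        rintro _ ⟨x, rfl | rfl | rfl, y, rfl | rfl | rfl, rfl⟩ <;>
          simp only [SetLike.mem_coe, h₀.idempotent, h₁.idempotent, mrr, m₀₁, m₀r, m₁r,
            m₁₀, mr₀, mr₁] <;>
          first | assumption | (apply key <;> assumption)
  mul_00 := h₀.idempotent
  mul_11 := h₁.idempotent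
  mul_rr := mrr
  mul_01 := m₀₁
  mul_0r := m₀r
  mul_1r := m₁r
  inner_00 := h₀.inner_self
  inner_11 := h₁.inner_self
  inner_rr := irr
  inner_01 := i₀₁
  inner_0r := i₀r
  inner_1r := i₁r

/-- The third axis is forced by the 2A product formula; its products and lengths follow from the
known square of a₀·a₁ at l = 1/8. -/
theorem isType2A {a₀ a₁ : V} (h₀ : IsMajoranaAxis mul a₀)
    (h₁ : IsMajoranaAxis mul a₁) (hV : IsMajoranaAlgebra mul A) (h₀₁ : a₁ ∈ plusPart mul a₀)
    (h₁₀ : a₀ ∈ plusPart mul a₁) (hl : inner ℝ a₀ a₁ = (1 / 8 : ℝ)) :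
    IsType2A mul a₀ a₁ (a₀ + a₁ - (8 : ℝ) • mul a₀ a₁) := by
  have hl' : inner ℝ a₁ a₀ = (1 / 8 : ℝ) := by rw [real_inner_comm, hl]
  have e0 := h₀.mul_mul_of_mem_plusPart hV h₀₁
  have e1 := h₁.mul_mul_of_mem_plusPart hV h₁₀
  have hpp := h₀.mul_mul_self_of_mem_plusPart h₁ hV h₀₁ h₁₀ rfl hl
  have hp' := hV.comm a₁ a₀
  have i0 : inner ℝ a₀ (mul a₀ a₁) = (1 / 8 : ℝ) := by
    rw [hV.assoc, h₀.idempotent, hl]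
  have i1 : inner ℝ a₁ (mul a₀ a₁) = (1 / 8 : ℝ) := by
    rw [← hp', hV.assoc, h₁.idempotent, hl']
  have ip : inner ℝ (mul a₀ a₁) (mul a₀ a₁) = (11 / 256 : ℝ) := by
    rw [← hp', ← hV.assoc, hp', e0, hl, inner_add_right, inner_smul_right, inner_smul_right,
      i1, hl']
    norm_num
  have ip0 : inner ℝ (mul a₀ a₁) a₀ = (1 / 8 : ℝ) := by rw [real_inner_comm, i0]
  have ip1 : inner ℝ (mul a₀ a₁) a₁ = (1 / 8 : ℝ) := by rw [real_inner_comm, i1]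
  have e0' := hV.comm (mul a₀ a₁) a₀
  have e1' := hV.comm (mul a₀ a₁) a₁
  rw [hl] at e0
  rw [hl', hp'] at e1
  rw [e0] at e0'
  rw [e1] at e1'
  apply isType2A_of_relations h₀ h₁ hV
  · module
  · simp only [map_sub, map_add, map_smul, h₀.idempotent, e0]
    module
  · simp only [map_sub, map_add, map_smul, h₁.idempotent, hp', e1]
    module
  · simp only [map_sub, map_add, map_smul, LinearMap.sub_apply, LinearMap.add_apply,
      LinearMap.smul_apply, h₀.idempotent, h₁.idempotent, hp', e0, e1, e0', e1', hpp]
    module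
  · exact hl
  all_goals
    simp only [inner_add_left, inner_add_right, inner_sub_left, inner_sub_right, inner_smul_left,
      inner_smul_right, h₀.inner_self, h₁.inner_self, hl, hl', i0, i1, ip, ip0, ip1, conj_trivial]
    norm_num

end IsMajoranaAxis

variable {b₀ b₁ b₂ s : V} {l : ℝ}

/-- Since b₀(b₁ + b₂) is 2s plus a combination of axes, the quadratic identity for multiplication by
b₀ on b₁ + b₂ can be solved for b₀·s. -/
theorem mul_sigma (h : IsMajoranaAxis mul b₀) (hV : IsMajoranaAlgebra mul A)
    (hX : b₁ + b₂ ∈ plusPart mul b₀) (h₀₁ : mul b₀ b₁ = s + (1 / 32 : ℝ) • (b₀ + b₁))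
    (h₀₂ : mul b₀ b₂ = s + (1 / 32 : ℝ) • (b₀ + b₂))
    (i₀₁ : inner ℝ b₀ b₁ = l) (i₀₂ : inner ℝ b₀ b₂ = l) :
    mul b₀ s = (7 / 32 : ℝ) • s + (3 / 4 * l - 25 / 1024) • b₀ + (7 / 2048 : ℝ) • (b₁ + b₂) := by
  have e := h.mul_mul_of_mem_plusPart hV hX
  simp only [map_add, map_smul, h₀₁, h₀₂, h.idempotent, inner_add_right, i₀₁, i₀₂] at e
  linear_combination (norm := module) (1 / 2 : ℝ) • e

theorem inner_sigma (h : IsMajoranaAxis mul b₀) (hV : IsMajoranaAlgebra mul A)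
    (h₀₁ : mul b₀ b₁ = s + (1 / 32 : ℝ) • (b₀ + b₁)) (i₀₁ : inner ℝ b₀ b₁ = l) :
    inner ℝ b₀ s = (31 * l - 1) / 32 := by
  have := hV.assoc b₀ b₀ b₁
  rw [h₀₁, h.idempotent, i₀₁] at this
  simp only [inner_add_right, inner_smul_right, h.inner_self, i₀₁] at this
  linear_combination this

/-- This is the resurrection identity for y = (b₁ + b₂)/2, whose 1/4-part involves `s`. The outcome
singles out b₀ although s·s does not, and `inner_of_order_three` exploits this. -/
theorem sigma_mul_sigma (h₀ : IsMajoranaAxis mul b₀) (h₁ : IsMajoranaAxis mul b₁)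
    (h₂ : IsMajoranaAxis mul b₂) (hV : IsMajoranaAlgebra mul A)
    (hX₀ : b₁ + b₂ ∈ plusPart mul b₀) (hX₁ : b₀ + b₂ ∈ plusPart mul b₁)
    (hX₂ : b₀ + b₁ ∈ plusPart mul b₂)
    (h₀₁ : mul b₀ b₁ = s + (1 / 32 : ℝ) • (b₀ + b₁))
    (h₀₂ : mul b₀ b₂ = s + (1 / 32 : ℝ) • (b₀ + b₂))
    (h₁₂ : mul b₁ b₂ = s + (1 / 32 : ℝ) • (b₁ + b₂))
    (i₀₁ : inner ℝ b₀ b₁ = l) (i₀₂ : inner ℝ b₀ b₂ = l) (i₁₂ : inner ℝ b₁ b₂ = l) :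
    mul s s = (l ^ 2 - 11 / 32768) • b₀ + (17 / 256 * l - 37 / 32768) • (b₁ + b₂)
      - (l / 4 + 37 / 2048) • s := by
  have h₁₀ : mul b₁ b₀ = s + (1 / 32 : ℝ) • (b₁ + b₀) := by rw [hV.comm, h₀₁, add_comm b₀]
  have h₂₀ : mul b₂ b₀ = s + (1 / 32 : ℝ) • (b₂ + b₀) := by rw [hV.comm, h₀₂, add_comm b₀]
  have h₂₁ : mul b₂ b₁ = s + (1 / 32 : ℝ) • (b₂ + b₁) := by rw [hV.comm, h₁₂, add_comm b₁]
  have i₁₀ : inner ℝ b₁ b₀ = l := by rw [real_inner_comm, i₀₁]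
  have i₂₀ : inner ℝ b₂ b₀ = l := by rw [real_inner_comm, i₀₂]
  have i₂₁ : inner ℝ b₂ b₁ = l := by rw [real_inner_comm, i₁₂]
  have s0 := mul_sigma h₀ hV hX₀ h₀₁ h₀₂ i₀₁ i₀₂
  have s1 := mul_sigma h₁ hV hX₁ h₁₀ h₁₂ i₁₀ i₁₂
  have s2 := mul_sigma h₂ hV hX₂ h₂₀ h₂₁ i₂₀ i₂₁
  have j0 := inner_sigma h₀ hV h₀₁ i₀₁
  have j1 := inner_sigma h₁ hV h₁₀ i₁₀
  have j2 := inner_sigma h₂ hV h₂₀ i₂₀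
  have hy : inner ℝ b₀ ((1 / 2 : ℝ) • (b₁ + b₂)) = l := by
    rw [inner_smul_right, inner_add_right, i₀₁, i₀₂]; ring
  have R := h₀.mul_quarterPart_self hV (y := (1 / 2 : ℝ) • (b₁ + b₂))
    (w := (1 / 2 : ℝ) • (b₁ + b₂) - l • b₀)
    (q := s + (1 / 32 - l) • b₀ + (1 / 64 : ℝ) • (b₁ + b₂))
    (Submodule.smul_mem _ _ hX₀) (by rw [hy])
    (by rw [hy, map_smul, map_add, h₀₁, h₀₂]; module)
  have s0' : mul s b₀ = _ := (hV.comm _ _).trans s0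
  have s1' : mul s b₁ = _ := (hV.comm _ _).trans s1
  have s2' : mul s b₂ = _ := (hV.comm _ _).trans s2
  simp only [map_sub, map_add, map_smul, LinearMap.sub_apply, LinearMap.add_apply,
    LinearMap.smul_apply, s0, s1, s2, s0', s1', s2', h₀₁, h₀₂, h₁₂, h₁₀, h₂₀, h₂₁,
    h₀.idempotent, h₁.idempotent, h₂.idempotent, inner_sub_left, inner_add_left, inner_add_right,
    inner_smul_left, inner_smul_right, i₀₁, i₀₂, i₁₂, i₁₀, i₂₀, i₂₁, h₀.inner_self, h₁.inner_self,
    h₂.inner_self, j0, j1, j2, conj_trivial] at R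
  linear_combination (norm := module) (1 / 4 : ℝ) • R

/-- The Norton–Sakuma theorem for a dihedral algebra with a product of order `3`: the inner
products are those of the algebras of type `3A` and `3C`. -/
theorem inner_of_order_three (h₀ : IsMajoranaAxis mul b₀) (h₁ : IsMajoranaAxis mul b₁)
    (h₂ : IsMajoranaAxis mul b₂) (hV : IsMajoranaAlgebra mul A)
    (hX₀ : b₁ + b₂ ∈ plusPart mul b₀) (hX₁ : b₀ + b₂ ∈ plusPart mul b₁)
    (hX₂ : b₀ + b₁ ∈ plusPart mul b₂)
    (h₀₁ : mul b₀ b₁ = s + (1 / 32 : ℝ) • (b₀ + b₁))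
    (h₀₂ : mul b₀ b₂ = s + (1 / 32 : ℝ) • (b₀ + b₂))
    (h₁₂ : mul b₁ b₂ = s + (1 / 32 : ℝ) • (b₁ + b₂))
    (i₀₁ : inner ℝ b₀ b₁ = l) (i₀₂ : inner ℝ b₀ b₂ = l) (i₁₂ : inner ℝ b₁ b₂ = l)
    (hne : b₀ ≠ b₁) : l = 13 / 256 ∨ l = 1 / 64 := by
  have R0 := sigma_mul_sigma h₀ h₁ h₂ hV hX₀ hX₁ hX₂ h₀₁ h₀₂ h₁₂ i₀₁ i₀₂ i₁₂
  have R1 := sigma_mul_sigma h₁ h₀ h₂ hV hX₁ hX₀ (by rwa [add_comm])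
    (by rw [hV.comm, h₀₁, add_comm b₀]) h₁₂ h₀₂ (by rw [real_inner_comm, i₀₁]) i₁₂ i₀₂
  -- The difference of the coefficients of b₀ and b₁ is l² − (17/256)l + 13/16384, with roots 13/256
  -- and 1/64.
  have h : ((l - 13 / 256) * (l - 1 / 64)) • (b₀ - b₁) = 0 := by
    linear_combination (norm := module) R1 - R0
  rcases smul_eq_zero.1 h with h | h
  · rcases mul_eq_zero.1 h with h | h
    · exact Or.inl (sub_eq_zero.1 h)
    · exact Or.inr (sub_eq_zero.1 h)
  · exact absurd (sub_eq_zero.1 h) hne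

/-- Under the assumption a₀·a₃ = 0, multiplications by a₀ and a₃ commute on V_+ of a₀ (Seress).
Applied to a₁ + a₅ this computes a₀·so. Pairing the result with a₀ gives the scalar relation, and
the quadratic identity for a₀ on `so` gives the vector relation. -/
theorem hexagon_relation {a₀ a₁ a₂ a₃ a₄ a₅ s₁ se so : V} {l le : ℝ}
    (h₀ : IsMajoranaAxis mul a₀) (h₃ : IsMajoranaAxis mul a₃) (hV : IsMajoranaAlgebra mul A)
    (hX₁ : a₁ + a₅ ∈ plusPart mul a₀) (hX₂ : a₂ + a₄ ∈ plusPart mul a₀)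
    (hso : so ∈ plusPart mul a₀) (hX₃ : a₂ + a₄ ∈ plusPart mul a₃)
    (h₀₃ : mul a₀ a₃ = 0)
    (h₀₁ : mul a₀ a₁ = s₁ + (1 / 32 : ℝ) • (a₀ + a₁))
    (h₀₅ : mul a₀ a₅ = s₁ + (1 / 32 : ℝ) • (a₀ + a₅))
    (h₃₂ : mul a₃ a₂ = s₁ + (1 / 32 : ℝ) • (a₃ + a₂))
    (h₃₄ : mul a₃ a₄ = s₁ + (1 / 32 : ℝ) • (a₃ + a₄))
    (h₀₂ : mul a₀ a₂ = se + (1 / 32 : ℝ) • (a₀ + a₂))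
    (h₀₄ : mul a₀ a₄ = se + (1 / 32 : ℝ) • (a₀ + a₄))
    (h₃₁ : mul a₃ a₁ = so + (1 / 32 : ℝ) • (a₃ + a₁))
    (h₃₅ : mul a₃ a₅ = so + (1 / 32 : ℝ) • (a₃ + a₅))
    (i₀₁ : inner ℝ a₀ a₁ = l) (i₀₅ : inner ℝ a₀ a₅ = l)
    (i₃₂ : inner ℝ a₃ a₂ = l) (i₃₄ : inner ℝ a₃ a₄ = l)
    (i₀₂ : inner ℝ a₀ a₂ = le) (i₀₄ : inner ℝ a₀ a₄ = le) :
    31 * l + le = 1 ∧ (32 / 3 : ℝ) • (so - se) - (a₁ + a₅) + (a₂ + a₄)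
      + (8 - 256 * l) • (a₀ - a₃) = 0 := by
  have i₀₃ : inner ℝ a₀ a₃ = (0 : ℝ) := by
    rw [← h₀.idempotent, ← hV.assoc, h₀₃, inner_zero_right]
  have e1 := mul_sigma h₀ hV hX₁ h₀₁ h₀₅ i₀₁ i₀₅
  have e2 := mul_sigma h₀ hV hX₂ h₀₂ h₀₄ i₀₂ i₀₄
  have e3 := mul_sigma h₃ hV hX₃ h₃₂ h₃₄ i₃₂ i₃₄
  have j1 := inner_sigma h₀ hV h₀₁ i₀₁
  have j2 : inner ℝ a₀ so = -l / 32 := by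
    have := hV.assoc a₀ a₃ a₁
    rw [h₀₃, h₃₁, inner_zero_left] at this
    simp only [inner_add_right, inner_smul_right, i₀₃, i₀₁] at this
    linear_combination this
  have e4 : mul a₀ so = (3 / 16 : ℝ) • s₁ + (1 / 32 : ℝ) • so + (3 / 4 * l - 24 / 1024) • a₃
      - (1 / 1024 : ℝ) • a₀ + (7 / 2048 : ℝ) • (a₂ + a₄) := by
    have C := h₀.mul_comm_of_mul_eq_zero hV h₀₃ hX₁
    simp only [map_add, map_smul, h₃₁, h₃₅, h₀₁, h₀₅, h₀₃, e3, hV.comm a₃ a₀] at C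
    linear_combination (norm := module) (1 / 2 : ℝ) • C
  have hle : 31 * l + le = 1 := by
    have := hV.assoc a₀ a₀ so
    rw [h₀.idempotent, e4] at this
    simp only [inner_add_right, inner_sub_right, inner_smul_right, j1, j2, i₀₃, h₀.inner_self,
      i₀₂, i₀₄] at this
    linear_combination (1024 / 7) * this
  obtain rfl : le = 1 - 31 * l := by linear_combination hle
  refine ⟨hle, ?_⟩
  have R := h₀.mul_mul_of_mem_plusPart hV hso
  rw [j2] at R
  simp only [e4, map_add, map_sub, map_smul, e1, h₀₃, h₀.idempotent, h₀₂, h₀₄] at R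
  linear_combination (norm := module) (-32768 / 21 : ℝ) • R
/-- There is no elementary abelian group of order `8` all of whose involutions correspond to axes
that pairwise generate algebras of type `2A`. -/
theorem eq_of_pure_rank_three {x y z xy xz yz xyz : V} (h : IsMajoranaAxis mul x)
    (hV : IsMajoranaAlgebra mul A) (m₁ : mul x y = (1 / 8 : ℝ) • (x + y - xy))
    (m₂ : mul x xy = (1 / 8 : ℝ) • (x + xy - y)) (m₃ : mul x z = (1 / 8 : ℝ) • (x + z - xz))
    (m₄ : mul x xz = (1 / 8 : ℝ) • (x + xz - z)) (m₅ : mul x yz = (1 / 8 : ℝ) • (x + yz - xyz))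
    (m₆ : mul x xyz = (1 / 8 : ℝ) • (x + xyz - yz)) (m₇ : mul y z = (1 / 8 : ℝ) • (y + z - yz))
    (m₈ : mul y xz = (1 / 8 : ℝ) • (y + xz - xyz)) (m₉ : mul xy z = (1 / 8 : ℝ) • (xy + z - xyz))
    (m₁₀ : mul xy xz = (1 / 8 : ℝ) • (xy + xz - yz)) : yz = xyz := by
  -- Both y − xy and z − xz are 1/4-eigenvectors of `x`. Their product is (xyz − yz)/4, which the
  -- fusion rule puts in V_1 ⊕ V_0.
  have e := h.mul_quarter_quarter hV (u := y - xy) (v := z - xz)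
    (by rw [map_sub, m₁, m₂]; module) (by rw [map_sub, m₃, m₄]; module)
  generalize (1 / 4 : ℝ) * inner ℝ (y - xy) (z - xz) = κ at e
  simp only [map_sub, map_add, map_smul, LinearMap.sub_apply, m₁, m₂, m₃, m₄, m₅, m₆, m₇, m₈, m₉,
    m₁₀] at e
  have e' : (1 / 16 : ℝ) • (xyz - yz) = κ • x := by rw [← e]; module
  -- Multiplication by `x` scales the left side of `e'` by 1/4 and fixes the right side, so both
  -- sides vanish.
  have e'' := congrArg (mul x) e'
  simp only [map_sub, map_smul, m₅, m₆, h.idempotent] at e''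
  linear_combination (norm := module) (64 / 3 : ℝ) • (e'' - e')

end Dihedral

/-! ### Reflections of a dihedral group, indexed by the integers. -/

section DihedralSequence

variable {G : Type*} [Group G]

/-- The reflections of the dihedral group generated by two involutions `t` and `s`. -/
def reflection (t s : G) (i : ℤ) : G := t * (t * s) ^ i

theorem reflection_zero (t s : G) : reflection t s 0 = t := by simp [reflection]

theorem reflection_one {t : G} (s : G) (ht : t * t = 1) : reflection t s 1 = s := by
  rw [reflection, zpow_one, ← mul_assoc, ht, one_mul]

theorem reflection_conj {t s : G} (ht : t * t = 1) (hs : s * s = 1) (i j : ℤ) :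
    reflection t s i * reflection t s j * (reflection t s i)⁻¹ = reflection t s (2 * i - j) := by
  have ht' : t⁻¹ = t := inv_eq_of_mul_eq_one_left ht
  have hs' : s⁻¹ = s := inv_eq_of_mul_eq_one_left hs
  have hr : ∀ k : ℤ, t * (t * s) ^ k * t = (t * s) ^ (-k) := by
    intro k
    have : t * (t * s) * t⁻¹ = (t * s)⁻¹ := by
      rw [mul_inv_rev, hs', ht', ← mul_assoc, ht, one_mul]
    rw [zpow_neg, ← inv_zpow, ← this, conj_zpow, ht']
  unfold reflection
  calc t * (t * s) ^ i * (t * (t * s) ^ j) * (t * (t * s) ^ i)⁻¹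
      = (t * (t * s) ^ i * t) * ((t * s) ^ (j - i)) * t := by
        rw [mul_inv_rev, ht', zpow_sub]; group
    _ = t * (t * (t * s) ^ (j - 2 * i) * t) := by
        rw [hr, ← zpow_add, ← mul_assoc, ← mul_assoc, ht, one_mul]
        congr 2; ring
    _ = _ := by rw [hr]; congr 2; ring

theorem reflection_eq {t s : G} (h6 : (t * s) ^ 6 = 1) {i j : ℤ} (h : 6 ∣ j - i) :
    reflection t s i = reflection t s j := by
  obtain ⟨m, hm⟩ := h
  obtain rfl : j = i + 6 * m := by omega
  have : (t * s) ^ (6 : ℤ) = 1 := by exact_mod_cast h6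
  rw [reflection, reflection, zpow_add, zpow_mul, this, one_zpow, mul_one]

end DihedralSequence

/-! ### Majorana representations: products of order 2 and 6 under (M8). -/

namespace MajoranaRepresentation

variable {G : Type*} [Group G] {T : Set G} {V : Type*} [NormedAddCommGroup V]
  [InnerProductSpace ℝ V] (R : MajoranaRepresentation G T V)

theorem isMajoranaAxis {t : G} (ht : t ∈ T) : IsMajoranaAxis R.mul (R.ψ t) :=
  R.isMajoranaAlgebra.axis _ (R.ψ_bij.mapsTo ht)

include R in
theorem mul_self_eq_one {t : G} (ht : t ∈ T) : t * t = 1 := by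
  have := pow_orderOf_eq_one t
  rwa [R.involution t ht, pow_two] at this

theorem mem_plusPart {t : G} (ht : t ∈ T) {v : V} (hv : R.φ t v = v) :
    v ∈ plusPart R.mul (R.ψ t) :=
  (R.isMajoranaAxis ht).mem_plusPart_of_fixed (R.φ_eq_tau t ht) hv

/-- `ψ(t) · ψ(s) - (ψ(t) + ψ(s)) / 32`, which is invariant under the dihedral group generated by
`t` and `s`. -/
noncomputable def sigma (t s : G) : V :=
  R.mul (R.ψ t) (R.ψ s) - (1 / 32 : ℝ) • (R.ψ t + R.ψ s)

theorem mul_eq_sigma (t s : G) :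
    R.mul (R.ψ t) (R.ψ s) = R.sigma t s + (1 / 32 : ℝ) • (R.ψ t + R.ψ s) := by
  rw [sigma, sub_add_cancel]

theorem sigma_comm (t s : G) : R.sigma t s = R.sigma s t := by
  rw [sigma, sigma, R.isMajoranaAlgebra.comm, add_comm (R.ψ t)]

/-- The difference of ψ(s) and its image under φ(t) is negated by τ(ψ(t)), hence is a
1/32-eigenvector of ψ(t). -/
theorem sigma_conj_left {t s : G} (ht : t ∈ T) (hs : s ∈ T) :
    R.sigma t (t * s * t⁻¹) = R.sigma t s := by
  have h2 : R.φ t (R.ψ (t * s * t⁻¹)) = R.ψ s := by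
    rw [← R.ψ_conj _ (R.conj_mem s hs t)]
    have := R.mul_self_eq_one ht
    congr 1
    have ht' : t⁻¹ = t := inv_eq_of_mul_eq_one_left this
    rw [ht']
    calc t * (t * s * t) * t = (t * t) * s * (t * t) := by group
      _ = s := by rw [this]; group
  have h := (R.isMajoranaAxis ht).mul_eq_of_tau_eq_neg (R.φ_eq_tau t ht)
    (v := R.ψ s - R.ψ (t * s * t⁻¹)) (by rw [map_sub, h2, ← R.ψ_conj s hs]; abel)
  rw [map_sub] at h
  rw [sigma, sigma]
  linear_combination (norm := module) -h

theorem φ_sigma {t s : G} (ht : t ∈ T) (hs : s ∈ T) (g : G) :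
    R.φ g (R.sigma t s) = R.sigma (g * t * g⁻¹) (g * s * g⁻¹) := by
  rw [sigma, sigma, map_sub, map_smul, map_add, R.φ_mul, R.ψ_conj t ht, R.ψ_conj s hs]

theorem φ_apply_of_commute {t s : G} (hs : s ∈ T) (hc : Commute t s) :
    R.φ t (R.ψ s) = R.ψ s := by
  rw [← R.ψ_conj s hs, hc.eq, mul_inv_cancel_right]

/-- The Norton–Sakuma theorem for a product of order `2`, with (M8). -/
theorem mul_mem_or_of_commute {t s : G} (ht : t ∈ T) (hs : s ∈ T) (hne : t ≠ s)
    (hc : Commute t s) : t * s ∈ T ∨ R.mul (R.ψ t) (R.ψ s) = 0 := by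
  have h₁ := R.mem_plusPart ht (R.φ_apply_of_commute hs hc)
  have h₂ := R.mem_plusPart hs (R.φ_apply_of_commute ht hc.symm)
  have hV := R.isMajoranaAlgebra
  rcases (R.isMajoranaAxis ht).inner_mul_of_mem_plusPart (R.isMajoranaAxis hs) hV h₁ h₂
    (fun h => hne (R.ψ_bij.injOn ht hs h)) with h | h
  · exact Or.inr ((R.isMajoranaAxis ht).mul_eq_zero_of_inner_eq_zero (R.isMajoranaAxis hs) hV h₁ h)
  · exact Or.inl (R.mem_of_type2A t ht s hs _
      ((R.isMajoranaAxis ht).isType2A (R.isMajoranaAxis hs) hV h₁ h₂ h)).1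

section Hexagon

variable {t s : G} (ht : t ∈ T) (hs : s ∈ T)

include R ht hs

theorem reflection_mem (i : ℤ) : reflection t s i ∈ T := by
  have h1 := R.mul_self_eq_one ht
  have h2 := R.mul_self_eq_one hs
  suffices reflection t s i ∈ T ∧ reflection t s (i + 1) ∈ T from this.1
  induction i with
  | zero => rw [reflection_zero, zero_add, reflection_one s h1]; exact ⟨ht, hs⟩
  | succ i ih =>
    refine ⟨ih.2, ?_⟩
    have := R.conj_mem _ ih.1 (reflection t s (i + 1))
    rw [reflection_conj h1 h2] at this
    convert this using 2; ring
  | pred i ih =>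
    rw [sub_add_cancel]
    refine ⟨?_, ih.1⟩
    have := R.conj_mem _ ih.2 (reflection t s (-i))
    rw [reflection_conj h1 h2] at this
    convert this using 2; ring

theorem φ_reflection (k i : ℤ) : R.φ (reflection t s k) (R.ψ (reflection t s i)) =
    R.ψ (reflection t s (2 * k - i)) := by
  rw [← R.ψ_conj _ (R.reflection_mem ht hs i),
    reflection_conj (R.mul_self_eq_one ht) (R.mul_self_eq_one hs)]

theorem φ_sigma_reflection (k i j : ℤ) :
    R.φ (reflection t s k) (R.sigma (reflection t s i) (reflection t s j)) =
      R.sigma (reflection t s (2 * k - i)) (reflection t s (2 * k - j)) := by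
  rw [R.φ_sigma (R.reflection_mem ht hs i) (R.reflection_mem ht hs j),
    reflection_conj (R.mul_self_eq_one ht) (R.mul_self_eq_one hs),
    reflection_conj (R.mul_self_eq_one ht) (R.mul_self_eq_one hs)]

theorem sigma_reflection (i d : ℤ) :
    R.sigma (reflection t s i) (reflection t s (i - d)) =
      R.sigma (reflection t s i) (reflection t s (i + d)) := by
  rw [← R.sigma_conj_left (R.reflection_mem ht hs i) (R.reflection_mem ht hs (i + d)),
    reflection_conj (R.mul_self_eq_one ht) (R.mul_self_eq_one hs)]
  congr 2; ring

theorem inner_reflection (k i j : ℤ) :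
    inner ℝ (R.ψ (reflection t s (2 * k - i))) (R.ψ (reflection t s (2 * k - j))) =
      (inner ℝ (R.ψ (reflection t s i)) (R.ψ (reflection t s j)) : ℝ) := by
  rw [← R.φ_reflection ht hs, ← R.φ_reflection ht hs, R.φ_inner]

/-- Both sides involve the reflection of index c + 1, and reflecting in it exchanges the indices c
and c + 2. -/
theorem sigma_shift_one (c : ℤ) :
    R.sigma (reflection t s (c + 1)) (reflection t s (c + 2)) =
      R.sigma (reflection t s c) (reflection t s (c + 1)) := by
  have := R.sigma_reflection ht hs (c + 1) 1
  rw [R.sigma_comm, add_sub_cancel_right] at this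
  rw [R.sigma_comm, R.sigma_comm (reflection t s c)]
  rw [R.sigma_comm] at this
  rw [this, R.sigma_comm]
  congr 2; ring

theorem sigma_shift_two (c : ℤ) :
    R.sigma (reflection t s (c + 2)) (reflection t s (c + 4)) =
      R.sigma (reflection t s c) (reflection t s (c + 2)) := by
  have := R.sigma_reflection ht hs (c + 2) 2
  rw [add_sub_cancel_right] at this
  rw [R.sigma_comm (reflection t s c), this]
  congr 2; ring

theorem inner_shift_one (c : ℤ) :
    inner ℝ (R.ψ (reflection t s (c + 1))) (R.ψ (reflection t s (c + 2))) =
      (inner ℝ (R.ψ (reflection t s c)) (R.ψ (reflection t s (c + 1))) : ℝ) := by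
  rw [real_inner_comm (R.ψ (reflection t s (c + 1))) (R.ψ (reflection t s c)),
    ← R.inner_reflection ht hs (c + 1) (c + 1) c]
  congr 3 <;> ring_nf

theorem inner_shift_two (c : ℤ) :
    inner ℝ (R.ψ (reflection t s (c + 2))) (R.ψ (reflection t s (c + 4))) =
      (inner ℝ (R.ψ (reflection t s c)) (R.ψ (reflection t s (c + 2))) : ℝ) := by
  rw [real_inner_comm (R.ψ (reflection t s (c + 2))) (R.ψ (reflection t s c)),
    ← R.inner_reflection ht hs (c + 2) (c + 2) c]
  congr 3 <;> ring_nf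

theorem φ_reflection' (h6 : (t * s) ^ 6 = 1) {k i j : ℤ} (h : 6 ∣ i + j - 2 * k) :
    R.φ (reflection t s k) (R.ψ (reflection t s i)) = R.ψ (reflection t s j) := by
  rw [R.φ_reflection ht hs, reflection_eq h6 (j := j) (by omega)]

theorem add_mem_plusPart (h6 : (t * s) ^ 6 = 1) (k i j : ℤ) (h : 6 ∣ i + j - 2 * k) :
    R.ψ (reflection t s i) + R.ψ (reflection t s j) ∈ plusPart R.mul (R.ψ (reflection t s k)) := by
  refine R.mem_plusPart (R.reflection_mem ht hs k) ?_
  rw [map_add, R.φ_reflection' ht hs h6 h,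
    R.φ_reflection' ht hs h6 (by omega : 6 ∣ j + i - 2 * k), add_comm]

theorem hexagon_relation_at (h6 : (t * s) ^ 6 = 1) (c : ℤ)
    (h0 : R.mul (R.ψ (reflection t s c)) (R.ψ (reflection t s (c + 3))) = 0) {l le : ℝ}
    (hl : inner ℝ (R.ψ (reflection t s c)) (R.ψ (reflection t s (c + 1))) = l)
    (hle : inner ℝ (R.ψ (reflection t s c)) (R.ψ (reflection t s (c + 2))) = le) :
    31 * l + le = 1 ∧
    (32 / 3 : ℝ) • (R.sigma (reflection t s (c + 1)) (reflection t s (c + 3)) -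
        R.sigma (reflection t s c) (reflection t s (c + 2)))
      - (R.ψ (reflection t s (c + 1)) + R.ψ (reflection t s (c + 5)))
      + (R.ψ (reflection t s (c + 2)) + R.ψ (reflection t s (c + 4)))
      + (8 - 256 * l) • (R.ψ (reflection t s c) - R.ψ (reflection t s (c + 3))) = 0 := by
  have hp : ∀ i j : ℤ, j = i + 6 → reflection t s i = reflection t s j := by
    exact fun i j h => reflection_eq h6 (by omega)
  have hmem := R.reflection_mem ht hs
  have hV := R.isMajoranaAlgebra
  have hin : ∀ k i j i' j' : ℤ, 6 ∣ i + i' - 2 * k → 6 ∣ j + j' - 2 * k →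
      inner ℝ (R.ψ (reflection t s i')) (R.ψ (reflection t s j')) =
        (inner ℝ (R.ψ (reflection t s i)) (R.ψ (reflection t s j)) : ℝ) := by
    intro k i j i' j' h h'
    rw [← R.φ_reflection' ht hs h6 h, ← R.φ_reflection' ht hs h6 h', R.φ_inner]
  have s01 := R.sigma_shift_one ht hs c
  have s12 := R.sigma_shift_one ht hs (c + 1)
  have s23 := R.sigma_shift_one ht hs (c + 2)
  have s05 := R.sigma_reflection ht hs c 1
  have s04 := R.sigma_reflection ht hs c 2
  have s35 := R.sigma_shift_two ht hs (c + 1)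
  have i01 := R.inner_shift_one ht hs c
  have i12 := R.inner_shift_one ht hs (c + 1)
  have i23 := R.inner_shift_one ht hs (c + 2)
  rw [hp (c - 1) (c + 5) (by ring)] at s05
  rw [hp (c - 2) (c + 4) (by ring)] at s04
  norm_num [add_assoc] at s12 s23 s35 i12 i23
  refine hexagon_relation (s₁ := R.sigma (reflection t s c) (reflection t s (c + 1)))
    (R.isMajoranaAxis (hmem c)) (R.isMajoranaAxis (hmem (c + 3))) hV
    (R.add_mem_plusPart ht hs h6 c _ _ (by omega)) (R.add_mem_plusPart ht hs h6 c _ _ (by omega)) ?_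
    (R.add_mem_plusPart ht hs h6 (c + 3) _ _ (by omega)) h0 (R.mul_eq_sigma _ _) ?_ ?_ ?_
    (R.mul_eq_sigma _ _) ?_ ?_ ?_ hl ?_ ?_ ?_ hle ?_
  -- The reflection of index c sends the pair (c + 1, c + 3) to (c + 5, c + 3) modulo 6, which has
  -- the same σ by `sigma_shift_two`.
  · refine R.mem_plusPart (hmem c) ?_
    rw [R.φ_sigma_reflection ht hs, hp (2 * c - (c + 1)) (c + 5) (by ring),
      hp (2 * c - (c + 3)) (c + 3) (by ring), R.sigma_comm, s35]
  · rw [R.mul_eq_sigma, s05]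
  · rw [R.mul_eq_sigma, R.sigma_comm, s12, s01]
  · rw [R.mul_eq_sigma, s23, s12, s01]
  · rw [R.mul_eq_sigma, s04]
  · rw [R.mul_eq_sigma, R.sigma_comm]
  · rw [R.mul_eq_sigma, s35]
  · rw [← hl]; exact hin c _ _ _ _ (by omega) (by omega)
  · rw [real_inner_comm, i12, i01, hl]
  · rw [i23, i12, i01, hl]
  · rw [← hle]; exact hin c _ _ _ _ (by omega) (by omega)

/-- If `t s` has order `6`, then the axes of the two central reflections are not those of an algebra
of type `2B`. -/
theorem mul_reflection_three_ne_zero (h6 : orderOf (t * s) = 6) :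
    R.mul (R.ψ (reflection t s 0)) (R.ψ (reflection t s 3)) ≠ 0 := by
  intro h0
  have hr6 : (t * s) ^ 6 = 1 := by rw [← h6]; exact pow_orderOf_eq_one _
  have hV := R.isMajoranaAlgebra
  have hax := fun i => R.isMajoranaAxis (R.reflection_mem ht hs i)
  have hmem := R.reflection_mem ht hs
  have hp : ∀ i j : ℤ, j = i + 6 → reflection t s i = reflection t s j := by
    exact fun i j h => reflection_eq hr6 (by omega)
  -- Reflecting in index 1 carries the opposite pair (0, 3) to (2, 5), so the hexagon relation also
  -- holds based at 2.
  have h2 : R.mul (R.ψ (reflection t s 2)) (R.ψ (reflection t s (2 + 3))) = 0 := by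
    have := congrArg (R.φ (reflection t s 1)) h0
    rw [R.φ_mul, R.φ_reflection ht hs, R.φ_reflection ht hs, map_zero] at this
    rwa [hp (2 * 1 - 3) 5 (by norm_num)] at this
  obtain ⟨l, hl⟩ : ∃ l : ℝ, inner ℝ (R.ψ (reflection t s 0)) (R.ψ (reflection t s 1)) = l :=
    ⟨_, rfl⟩
  obtain ⟨le, hle⟩ : ∃ l : ℝ, inner ℝ (R.ψ (reflection t s 0)) (R.ψ (reflection t s 2)) = l :=
    ⟨_, rfl⟩
  have i12 := R.inner_shift_one ht hs 0
  have i23 := R.inner_shift_one ht hs 1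
  have i24 := R.inner_shift_two ht hs 0
  have i40 := R.inner_shift_two ht hs 2
  have s24 := R.sigma_shift_two ht hs 0
  have s40 := R.sigma_shift_two ht hs 2
  have s35 := R.sigma_shift_two ht hs 1
  norm_num at i12 i23 i24 i40 s24 s40 s35
  rw [← hp 0 6 rfl] at i40 s40
  obtain ⟨hsum, e0⟩ := R.hexagon_relation_at ht hs hr6 0 (by simpa using h0) (by simpa using hl)
    (by simpa using hle)
  obtain ⟨-, e2⟩ := R.hexagon_relation_at ht hs hr6 2 h2 (l := l) (le := le)
    (by norm_num; rw [i23, i12, hl]) (by norm_num; rw [i24, hle])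
  norm_num at e0 e2
  rw [← hp 0 6 rfl, ← hp 1 7 rfl, s24, s35] at e2
  have hne : R.ψ (reflection t s 0) ≠ R.ψ (reflection t s 2) := by
    intro h
    have := R.ψ_bij.injOn (hmem 0) (hmem 2) h
    rw [reflection, reflection, zpow_zero, mul_right_inj] at this
    have h' : (t * s) ^ 2 = 1 := by exact_mod_cast this.symm
    have := orderOf_dvd_of_pow_eq_one h'
    rw [h6] at this
    norm_num at this
  -- The σ-terms of the relations based at 0 and 2 coincide, so the difference involves axes only.
  have hrel : (7 - 256 * l) • (R.ψ (reflection t s 0) - R.ψ (reflection t s 2)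
      - R.ψ (reflection t s 3) + R.ψ (reflection t s 5)) = 0 := by
    linear_combination (norm := module) e0 - e2
  have h3 : le = 13 / 256 ∨ le = 1 / 64 :=
    inner_of_order_three (hax 0) (hax 2) (hax 4) hV
      (R.add_mem_plusPart ht hs hr6 0 2 4 (by norm_num))
      (R.add_mem_plusPart ht hs hr6 2 0 4 (by norm_num))
      (R.add_mem_plusPart ht hs hr6 4 0 2 (by norm_num))
      (R.mul_eq_sigma _ _) (by rw [R.mul_eq_sigma, R.sigma_comm, s40, s24])
      (by rw [R.mul_eq_sigma, s24]) hle (by rw [real_inner_comm, i40, i24, hle])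
      (by rw [i24, hle]) hne
  have i03 : inner ℝ (R.ψ (reflection t s 0)) (R.ψ (reflection t s 3)) = (0 : ℝ) := by
    rw [← (hax 0).idempotent, ← hV.assoc, h0, inner_zero_right]
  have i05 : inner ℝ (R.ψ (reflection t s 0)) (R.ψ (reflection t s 5)) = l := by
    have := R.inner_reflection ht hs 0 0 1
    rw [hl] at this
    rw [← this, hp (2 * 0 - 1) 5 (by norm_num)]
    rfl
  -- With 31l + le = 1, the root l = 7/256 gives le = 39/256; in the other case pairing with axis 0
  -- gives 1 − le + l = 0, so le = 1. Neither value is 13/256 or 1/64.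
  rcases smul_eq_zero.1 hrel with h | h
  · rcases h3 with rfl | rfl <;> linarith
  · have := congrArg (inner ℝ (R.ψ (reflection t s 0))) h
    simp only [inner_add_right, inner_sub_right, (hax 0).inner_self, hle, i03, i05,
      inner_zero_right] at this
    rcases h3 with rfl | rfl <;> linarith

end Hexagon

include R in
/-- The Norton–Sakuma theorem for a product of order `6`, with (M8). -/
theorem isCubeClosed : IsCubeClosed T where
  conj_mem := R.conj_mem
  cube_mem t ht s hs h6 := by
    have h1 := R.mul_self_eq_one ht
    have h2 := R.mul_self_eq_one hs
    have hr6 : (t * s) ^ 6 = 1 := by rw [← h6]; exact pow_orderOf_eq_one _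
    have hmem := R.reflection_mem ht hs
    -- The cube is the product of two opposite reflections, which commute, so the dichotomy for
    -- commuting axes applies.
    have e : reflection t s 0 * reflection t s 3 = (t * s) ^ 3 := by
      rw [reflection_zero, reflection, ← mul_assoc, h1, one_mul]
      norm_cast
    have hcomm : Commute (reflection t s 0) (reflection t s 3) := by
      have := reflection_conj h1 h2 0 3
      rw [reflection_eq hr6 (i := 2 * 0 - 3) (j := 3) (by norm_num)] at this
      rwa [mul_inv_eq_iff_eq_mul] at this
    have hne : reflection t s 0 ≠ reflection t s 3 := by
      intro h
      rw [reflection, reflection, zpow_zero, mul_right_inj] at h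
      have h' : (t * s) ^ 3 = 1 := by exact_mod_cast h.symm
      have := orderOf_dvd_of_pow_eq_one h'
      rw [h6] at this
      norm_num at this
    rw [← e]
    exact (R.mul_mem_or_of_commute (hmem 0) (hmem 3) hne hcomm).resolve_right
      (R.mul_reflection_three_ne_zero ht hs h6)

include R in
/-- The set `T` does not contain all involutions of an elementary abelian subgroup of
order `8`. -/
theorem not_pure_rank_three {x y z : G} (hxy : Commute x y) (hx : x ∈ T)
    (hy : y ∈ T) (hz : z ∈ T) (hxy' : x * y ∈ T) (hxz' : x * z ∈ T) (hyz' : y * z ∈ T)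
    (hxyz : x * y * z ∈ T) : False := by
  have x2 := R.mul_self_eq_one hx
  have y2 := R.mul_self_eq_one hy
  have z2 := R.mul_self_eq_one hz
  have key : ∀ u ∈ T, ∀ v ∈ T, ∀ w ∈ T, u * v = w →
      R.mul (R.ψ u) (R.ψ v) = (1 / 8 : ℝ) • (R.ψ u + R.ψ v - R.ψ w) := by
    rintro u hu v hv w hw rfl
    exact (R.type2A_of_mul_eq_one u hu v hv _ hw (R.mul_self_eq_one hw)).mul_01
  have h := eq_of_pure_rank_three (R.isMajoranaAxis hx) R.isMajoranaAlgebra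
    (key _ hx _ hy _ hxy' rfl) (key _ hx _ hxy' _ hy (by rw [← mul_assoc, x2, one_mul]))
    (key _ hx _ hz _ hxz' rfl) (key _ hx _ hxz' _ hz (by rw [← mul_assoc, x2, one_mul]))
    (key _ hx _ hyz' _ hxyz (mul_assoc _ _ _).symm)
    (key _ hx _ hxyz _ hyz' (by rw [← mul_assoc, ← mul_assoc, x2, one_mul]))
    (key _ hy _ hz _ hyz' rfl)
    (key _ hy _ hxz' _ hxyz (by rw [← mul_assoc, hxy.eq]))
    (key _ hxy' _ hz _ hxyz rfl)
    (key _ hxy' _ hxz' _ hyz' (by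
      rw [hxy.eq, mul_assoc, ← mul_assoc x x z, x2, one_mul]))
  -- Equal axes give yz = xyz, so x = 1, which is not an involution.
  have h1 := R.ψ_bij.injOn hyz' hxyz h
  rw [mul_assoc, right_eq_mul] at h1
  have := R.involution x hx
  rw [h1, orderOf_one] at this
  norm_num at this

end MajoranaRepresentation

/-! ### Split triples: normal form and order. -/

section Groups

variable {G : Type*} [Group G]

theorem mem_of_mem_closure_pair {p p' x : G} (hp : p * p = 1) (hp' : p' * p' = 1)
    (hb : p' * p * p' = p * p' * p) (hx : x ∈ Subgroup.closure {p, p'}) :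
    x = 1 ∨ x = p ∨ x = p' ∨ x = p * p' ∨ x = p' * p ∨ x = p * p' * p := by
  have ip : p⁻¹ = p := inv_eq_of_mul_eq_one_left hp
  have ip' : p'⁻¹ = p' := inv_eq_of_mul_eq_one_left hp'
  have c1 : ∀ y, p * (p * y) = y := fun y => by rw [← mul_assoc, hp, one_mul]
  have c2 : ∀ y, p' * (p' * y) = y := fun y => by rw [← mul_assoc, hp', one_mul]
  have hb0 : p' * (p * p') = p * (p' * p) := by rw [← mul_assoc, hb, mul_assoc]
  have hb1 : p' * (p * (p' * p)) = p * p' := by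
    rw [← mul_assoc p, ← mul_assoc p', ← mul_assoc p', hb, mul_assoc, hp, mul_one]
  induction hx using Subgroup.closure_induction_left with
  | one => exact Or.inl rfl
  | mul_left y hy z hz ih =>
    rcases hy with rfl | rfl <;>
      rcases ih with rfl | rfl | rfl | rfl | rfl | rfl <;> simp [mul_assoc, *]
  | inv_mul_cancel y hy z hz ih =>
    rcases hy with rfl | rfl <;>
      rcases ih with rfl | rfl | rfl | rfl | rfl | rfl <;> simp [mul_assoc, *]

theorem card_closure_pair_le {p p' : G} (hp : p * p = 1) (hp' : p' * p' = 1)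
    (hb : p' * p * p' = p * p' * p) :
    Finite (Subgroup.closure {p, p'}) ∧ Nat.card (Subgroup.closure {p, p'}) ≤ 6 := by
  classical
  have hsub : (Subgroup.closure {p, p'} : Set G) ⊆
      (({1, p, p', p * p', p' * p, p * p' * p} : Finset G) : Set G) := by
    intro x hx
    simpa using mem_of_mem_closure_pair hp hp' hb hx
  refine ⟨(Finset.finite_toSet _).subset hsub, ?_⟩
  have := Set.ncard_le_ncard hsub (Finset.finite_toSet _)
  rw [Set.ncard_coe_finset] at this
  exact this.trans Finset.card_le_six

/-- The generators `p, q, c` satisfy relations that exhibit the group as a quotient of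
`(S₃ × S₃) : 2`, where `c` normalizes the two factors `⟨p, p^c⟩` and `⟨q, q^c⟩`. -/
structure IsSplitTriple (p q c : G) : Prop where
  closure_eq : Subgroup.closure {p, q, c} = ⊤
  sq_left : p * p = 1
  sq_right : q * q = 1
  sq_conj : c * c = 1
  comm : q * p = p * q
  comm_conj : c * q * c * p = p * (c * q * c)
  pow_left : (p * c) ^ 6 = 1
  pow_right : (q * c) ^ 6 = 1

namespace IsSplitTriple

variable {p q c : G}

theorem symm (h : IsSplitTriple p q c) : IsSplitTriple q p c where
  closure_eq := by rw [Set.insert_comm, h.closure_eq]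
  sq_left := h.sq_right
  sq_right := h.sq_left
  sq_conj := h.sq_conj
  comm := h.comm.symm
  comm_conj := by
    have cc := h.sq_conj
    calc c * p * c * q = c * p * c * q * (c * c) := by rw [cc, mul_one]
      _ = c * (p * (c * q * c)) * c := by simp only [mul_assoc]
      _ = c * (c * q * c * p) * c := by rw [h.comm_conj]
      _ = (c * c) * (q * (c * p * c)) := by simp only [mul_assoc]
      _ = _ := by rw [cc, one_mul]
  pow_left := h.pow_right
  pow_right := h.pow_left

theorem sq_left_conj (h : IsSplitTriple p q c) : c * p * c * (c * p * c) = 1 := by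
  calc c * p * c * (c * p * c) = c * p * (c * c) * p * c := by simp only [mul_assoc]
    _ = c * (p * p) * c := by rw [h.sq_conj, mul_one]; simp only [mul_assoc]
    _ = 1 := by rw [h.sq_left, mul_one, h.sq_conj]

/-- Since (pc)² = p·p^c, the relation (pc)⁶ = 1 says (p·p^c)³ = 1, which for involutions is the
braid relation. -/
theorem braid (h : IsSplitTriple p q c) :
    c * p * c * p * (c * p * c) = p * (c * p * c) * p := by
  have e : (p * (c * p * c) * p) * (c * p * c * p * (c * p * c)) = 1 := by
    rw [← h.pow_left]
    simp only [pow_succ, pow_zero, one_mul, mul_assoc]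
  have e' : (p * (c * p * c) * p) * (p * (c * p * c) * p) = 1 := by
    calc (p * (c * p * c) * p) * (p * (c * p * c) * p)
        = p * (c * p * c) * (p * p) * (c * p * c) * p := by simp only [mul_assoc]
      _ = p * (c * p * c * (c * p * c)) * p := by
        rw [h.sq_left, mul_one]; simp only [mul_assoc]
      _ = 1 := by rw [h.sq_left_conj, mul_one, h.sq_left]
  exact mul_left_cancel (e.trans e'.symm)

/-- Every element is `x y` or `x y c` with `x ∈ ⟨p, p^c⟩` and `y ∈ ⟨q, q^c⟩`. -/
theorem exists_eq (h : IsSplitTriple p q c) (g : G) :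
    ∃ x ∈ Subgroup.closure {p, c * p * c}, ∃ y ∈ Subgroup.closure {q, c * q * c},
      ∃ k : Bool, g = x * y * (if k then c else 1) := by
  have ic : c⁻¹ = c := inv_eq_of_mul_eq_one_left h.sq_conj
  have norm : ∀ r : G, ∀ x ∈ Subgroup.closure {r, c * r * c},
      c * x * c ∈ Subgroup.closure {r, c * r * c} := by
    intro r x hx
    have : Subgroup.closure {r, c * r * c} ≤
        (Subgroup.closure {r, c * r * c}).comap (MulAut.conj c).toMonoidHom := by
      rw [Subgroup.closure_le]
      rintro y (rfl | rfl)
      · exact Subgroup.subset_closure (by simp [ic])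
      · refine Subgroup.subset_closure (Or.inl ?_)
        simp only [MulEquiv.coe_toMonoidHom, MulAut.conj_apply, ic]
        calc c * (c * r * c) * c = (c * c) * r * (c * c) := by simp only [mul_assoc]
          _ = r := by rw [h.sq_conj]; simp
    have := this hx
    rwa [Subgroup.mem_comap, MulEquiv.coe_toMonoidHom, MulAut.conj_apply, ic] at this
  have hcomm : ∀ x ∈ Subgroup.closure {p, c * p * c}, q * x = x * q := by
    intro x hx
    have : Subgroup.closure {p, c * p * c} ≤ Subgroup.centralizer {q} := by
      rw [Subgroup.closure_le]
      rintro y (rfl | rfl)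
      · exact Subgroup.mem_centralizer_singleton_iff.2 h.comm.symm
      · exact Subgroup.mem_centralizer_singleton_iff.2 h.symm.comm_conj
    exact (Subgroup.mem_centralizer_singleton_iff.1 (this hx)).symm
  have step : ∀ s ∈ ({p, q, c} : Set G), ∀ g : G,
      (∃ x ∈ Subgroup.closure {p, c * p * c}, ∃ y ∈ Subgroup.closure {q, c * q * c},
        ∃ k : Bool, g = x * y * (if k then c else 1)) →
      ∃ x ∈ Subgroup.closure {p, c * p * c}, ∃ y ∈ Subgroup.closure {q, c * q * c},
        ∃ k : Bool, s * g = x * y * (if k then c else 1) := by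
    rintro s (rfl | rfl | rfl) g ⟨x, hx, y, hy, k, rfl⟩
    · exact ⟨s * x, mul_mem (Subgroup.subset_closure (by simp)) hx, y, hy, k,
        by simp only [mul_assoc]⟩
    · refine ⟨x, hx, s * y, mul_mem (Subgroup.subset_closure (by simp)) hy, k, ?_⟩
      rw [← mul_assoc, ← mul_assoc, hcomm x hx, ← mul_assoc]
    · refine ⟨_, norm _ x hx, _, norm _ y hy, !k, ?_⟩
      have : s * x * s * (s * y * s) = s * x * y * s := by
        calc s * x * s * (s * y * s) = s * x * (s * s) * y * s := by simp only [mul_assoc]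
          _ = _ := by rw [h.sq_conj, mul_one]
      rw [this]
      cases k <;> simp [mul_assoc, h.sq_conj]
  have hg : g ∈ Subgroup.closure {p, q, c} := by rw [h.closure_eq]; trivial
  induction hg using Subgroup.closure_induction_left with
  | one => exact ⟨1, one_mem _, 1, one_mem _, false, by simp⟩
  | mul_left s hs z hz ih => exact step s hs z ih
  | inv_mul_cancel s hs z hz ih =>
    have : s⁻¹ = s := by
      rcases hs with rfl | rfl | rfl
      · exact inv_eq_of_mul_eq_one_left h.sq_left
      · exact inv_eq_of_mul_eq_one_left h.sq_right
      · exact ic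
    rw [this]
    exact step s hs z ih

theorem sq_right_conj (h : IsSplitTriple p q c) : c * q * c * (c * q * c) = 1 :=
  h.symm.sq_left_conj

theorem surjective (h : IsSplitTriple p q c) : Function.Surjective
    (fun z : Subgroup.closure {p, c * p * c} × Subgroup.closure {q, c * q * c} × Bool =>
      (z.1 : G) * z.2.1 * (if z.2.2 then c else 1)) := by
  intro g
  obtain ⟨x, hx, y, hy, k, rfl⟩ := h.exists_eq g
  exact ⟨⟨⟨x, hx⟩, ⟨y, hy⟩, k⟩, rfl⟩

theorem card_le (h : IsSplitTriple p q c) : Finite G ∧ Nat.card G ≤ 72 := by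
  obtain ⟨f1, c1⟩ := card_closure_pair_le h.sq_left h.sq_left_conj h.braid
  obtain ⟨f2, c2⟩ := card_closure_pair_le h.sq_right h.sq_right_conj h.symm.braid
  refine ⟨Finite.of_surjective _ h.surjective, ?_⟩
  have := Nat.card_le_card_of_surjective _ h.surjective
  have hB : Nat.card Bool = 2 := by simp
  rw [Nat.card_prod, Nat.card_prod, hB] at this
  nlinarith

/-- The domain has at most 6·6·2 = 72 elements, so a surjection from it onto a group of order 72 is
a bijection. -/
theorem injective (h : IsSplitTriple p q c) (hG : Nat.card G = 72) : Function.Injective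
    (fun z : Subgroup.closure {p, c * p * c} × Subgroup.closure {q, c * q * c} × Bool =>
      (z.1 : G) * z.2.1 * (if z.2.2 then c else 1)) := by
  obtain ⟨f1, c1⟩ := card_closure_pair_le h.sq_left h.sq_left_conj h.braid
  obtain ⟨f2, c2⟩ := card_closure_pair_le h.sq_right h.sq_right_conj h.symm.braid
  refine (h.surjective.bijective_of_nat_card_le ?_).1
  rw [hG, Nat.card_prod, Nat.card_prod]
  have : Nat.card Bool = 2 := by simp
  rw [this]
  nlinarith

/-- If p^c = p, then ⟨p, p^c⟩ has at most 2 elements and |G| ≤ 2·6·2 = 24. -/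
theorem mul_conj_ne_one (h : IsSplitTriple p q c) (hG : Nat.card G = 72) :
    p * (c * p * c) ≠ 1 := by
  intro h1
  obtain ⟨f2, c2⟩ := card_closure_pair_le h.sq_right h.sq_right_conj h.symm.braid
  have hp' : c * p * c = p := by
    rw [← inv_eq_of_mul_eq_one_right h1, inv_eq_of_mul_eq_one_left h.sq_left]
  have hsub : (Subgroup.closure {p, c * p * c} : Set G) ⊆ {1, p} := by
    intro x hx
    have := mem_of_mem_closure_pair h.sq_left h.sq_left_conj h.braid hx
    rw [hp', h.sq_left, one_mul] at this
    simp only [Set.mem_insert_iff, Set.mem_singleton_iff]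
    tauto
  have c1 := (Set.ncard_le_ncard hsub (Set.toFinite _)).trans (Set.ncard_insert_le _ _)
  rw [Set.ncard_singleton] at c1
  have c1' : Nat.card (Subgroup.closure {p, c * p * c}) ≤ 2 := c1
  have : Finite (Subgroup.closure {p, c * p * c}) := (Set.toFinite {1, p}).subset hsub
  have := Nat.card_le_card_of_surjective _ h.surjective
  rw [hG, Nat.card_prod, Nat.card_prod] at this
  have hB : Nat.card Bool = 2 := by simp
  rw [hB] at this
  nlinarith

theorem mul_mul_conj_ne_one (h : IsSplitTriple p q c) (hG : Nat.card G = 72) {x y : G}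
    (hx : x ∈ Subgroup.closure {p, c * p * c}) (hy : y ∈ Subgroup.closure {q, c * q * c}) :
    x * y * c ≠ 1 := by
  intro h1
  have := h.injective hG (a₁ := ⟨⟨x, hx⟩, ⟨y, hy⟩, true⟩) (a₂ := ⟨1, 1, false⟩) (by simpa using h1)
  simp at this

theorem eq_one_of_mul_eq_one (h : IsSplitTriple p q c) (hG : Nat.card G = 72) {x y : G}
    (hx : x ∈ Subgroup.closure {p, c * p * c}) (hy : y ∈ Subgroup.closure {q, c * q * c})
    (h1 : x * y = 1) : x = 1 ∧ y = 1 := by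
  have := h.injective hG (a₁ := ⟨⟨x, hx⟩, ⟨y, hy⟩, false⟩) (a₂ := ⟨1, 1, false⟩) (by simpa using h1)
  simpa using this

end IsSplitTriple

/-! ### Elementary abelian groups of order 8 and word identities. -/

theorem pow_val_add {p : G} (hp : p * p = 1) (x y : ZMod 2) :
    p ^ (x + y).val = p ^ x.val * p ^ y.val := by
  have h : ∀ x : ZMod 2, x = 0 ∨ x = 1 := by decide
  have h0 : (0 : ZMod 2).val = 0 := rfl
  have h1 : (1 : ZMod 2).val = 1 := rfl
  have h2 : (1 + 1 : ZMod 2).val = 0 := rfl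
  rcases h x with rfl | rfl <;> rcases h y with rfl | rfl <;> simp [h0, h1, h2, hp]

/-- The homomorphism from `2³` given by three commuting elements of order at most `2`. -/
def ofCommutingInvolutions {p q d : G} (hp : p * p = 1) (hq : q * q = 1) (hd : d * d = 1)
    (hpq : Commute p q) (hpd : Commute p d) (hqd : Commute q d) :
    Multiplicative (Fin 3 → ZMod 2) →* G where
  toFun f := p ^ (f.toAdd 0).val * q ^ (f.toAdd 1).val * d ^ (f.toAdd 2).val
  map_one' := by simp
  map_mul' f g := by
    simp only [toAdd_mul, Pi.add_apply, pow_val_add hp, pow_val_add hq, pow_val_add hd]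
    generalize (f.toAdd 0).val = i, (f.toAdd 1).val = j, (f.toAdd 2).val = k,
      (g.toAdd 0).val = i', (g.toAdd 1).val = j', (g.toAdd 2).val = k'
    have e1 := (hpq.pow_pow i' j).eq
    have e2 := (hpd.pow_pow i' k).eq
    have e3 := (hqd.pow_pow j' k).eq
    calc p ^ i * p ^ i' * (q ^ j * q ^ j') * (d ^ k * d ^ k')
        = p ^ i * (p ^ i' * q ^ j) * (q ^ j' * d ^ k) * d ^ k' := by simp only [mul_assoc]
      _ = p ^ i * q ^ j * (p ^ i' * d ^ k) * q ^ j' * d ^ k' := by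
        rw [e1, e3]; simp only [mul_assoc]
      _ = _ := by rw [e2]; simp only [mul_assoc]

theorem range_ofCommutingInvolutions {p q d : G} (hp : p * p = 1) (hq : q * q = 1) (hd : d * d = 1)
    (hpq : Commute p q) (hpd : Commute p d) (hqd : Commute q d) :
    (ofCommutingInvolutions hp hq hd hpq hpd hqd).range = Subgroup.closure {p, q, d} := by
  have h1 : (1 : ZMod 2).val = 1 := rfl
  apply le_antisymm
  · rintro _ ⟨f, rfl⟩
    refine mul_mem (mul_mem (pow_mem ?_ _) (pow_mem ?_ _)) (pow_mem ?_ _) <;>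
      exact Subgroup.subset_closure (by simp)
  · rw [Subgroup.closure_le]
    rintro x (rfl | rfl | rfl)
    · exact ⟨Multiplicative.ofAdd ![1, 0, 0], by simp [ofCommutingInvolutions, h1]⟩
    · exact ⟨Multiplicative.ofAdd ![0, 1, 0], by simp [ofCommutingInvolutions, h1]⟩
    · exact ⟨Multiplicative.ofAdd ![0, 0, 1], by simp [ofCommutingInvolutions, h1]⟩

theorem mem_closure_triple {p q d k : G} (hp : p * p = 1) (hq : q * q = 1) (hd : d * d = 1)
    (hpq : Commute p q) (hpd : Commute p d) (hqd : Commute q d)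
    (hk : k ∈ Subgroup.closure {p, q, d}) :
    k = 1 ∨ k = p ∨ k = q ∨ k = d ∨ k = p * q ∨ k = p * d ∨ k = q * d ∨ k = p * q * d := by
  rw [← range_ofCommutingInvolutions hp hq hd hpq hpd hqd] at hk
  obtain ⟨f, rfl⟩ := hk
  have h : ∀ x : ZMod 2, x = 0 ∨ x = 1 := by decide
  have h1 : (1 : ZMod 2).val = 1 := rfl
  simp only [ofCommutingInvolutions, MonoidHom.coe_mk, OneHom.coe_mk]
  rcases h (f.toAdd 0) with e0 | e0 <;> rcases h (f.toAdd 1) with e1 | e1 <;>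
    rcases h (f.toAdd 2) with e2 | e2 <;> rw [e0, e1, e2] <;> simp [h1]

theorem isElementaryAbelian8_closure {p q d : G} (hp : p * p = 1) (hq : q * q = 1) (hd : d * d = 1)
    (hpq : Commute p q) (hpd : Commute p d) (hqd : Commute q d) (p1 : p ≠ 1) (q1 : q ≠ 1)
    (d1 : d ≠ 1) (pq1 : p * q ≠ 1) (pd1 : p * d ≠ 1) (qd1 : q * d ≠ 1) (pqd1 : p * q * d ≠ 1) :
    IsElementaryAbelian8 (Subgroup.closure {p, q, d}) := by
  have hinj : Function.Injective (ofCommutingInvolutions hp hq hd hpq hpd hqd) := by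
    rw [injective_iff_map_eq_one]
    intro f hf
    have h : ∀ x : ZMod 2, x = 0 ∨ x = 1 := by decide
    have h1 : (1 : ZMod 2).val = 1 := rfl
    simp only [ofCommutingInvolutions, MonoidHom.coe_mk, OneHom.coe_mk] at hf
    suffices f.toAdd 0 = 0 ∧ f.toAdd 1 = 0 ∧ f.toAdd 2 = 0 by
      apply Multiplicative.toAdd.injective
      funext i
      fin_cases i
      exacts [this.1, this.2.1, this.2.2]
    rcases h (f.toAdd 0) with e0 | e0 <;> rcases h (f.toAdd 1) with e1 | e1 <;>
      rcases h (f.toAdd 2) with e2 | e2 <;> rw [e0, e1, e2] at hf <;>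
      simp_all
  exact ⟨((MonoidHom.ofInjective hinj).trans (MulEquiv.subgroupCongr
    (range_ofCommutingInvolutions hp hq hd hpq hpd hqd))).symm⟩

/-- Word identities in `(S₃ × S₃) : 2`, with `p'` and `q'` the conjugates of `p` and `q`
under `c`. -/
theorem split_word_identities {p p' q q' c : G} (pp : p * p = 1) (pp' : p' * p' = 1)
    (qq : q * q = 1) (qq' : q' * q' = 1) (cc : c * c = 1) (cp : c * p = p' * c)
    (cp' : c * p' = p * c) (cq : c * q = q' * c) (cq' : c * q' = q * c) (qp : q * p = p * q)
    (qp' : q * p' = p' * q) (qp2 : q' * p = p * q') (qp3 : q' * p' = p' * q')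
    (bp : p' * (p * p') = p * (p' * p)) (bq : q' * (q * q') = q * (q' * q)) :
    (p * c) ^ 2 = p * p' ∧ (p * c) ^ 3 = p * p' * p * c ∧
    (p * q * c) ^ 2 = (p * p') * (q * q') ∧
    (p * q * c) ^ 3 = (p * p' * p) * (q * q' * q) * c ∧
    (p * q * c) ^ 3 * (p * q * c) ^ 3 = 1 ∧
    (p * q * c) ^ 3 * p = p * (p * q * c) ^ 3 ∧
    p * (p * q * c) ^ 3 = p * p' * (q * c) ^ 3 * (p' * p) ∧
    p * q * (p * q * c) ^ 3 = p * p' * q * q' * c * (q' * q * p' * p) := by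
  -- The relations act as rewriting rules that move `c` to the right and letters of `q` past letters
  -- of `p`. These helpers extend each rule to the interior of a right-associated word.
  have tail : ∀ {x y z : G}, x * y = z → ∀ w, x * (y * w) = z * w := by
    rintro x y _ rfl w; rw [mul_assoc]
  have one : ∀ {x y : G}, x * y = 1 → ∀ w, x * (y * w) = w := by
    intro x y h w; rw [tail h, one_mul]
  have tail3 : ∀ {x y z u v t: G}, x * (y * z) = u * (v * t) →
      ∀ w, x * (y * (z * w)) = u * (v * (t * w)) := by
    intro x y z u v t h w
    rw [← mul_assoc y, ← mul_assoc, h]; simp only [mul_assoc]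
  simp only [pow_succ, pow_zero, one_mul, mul_assoc, pp, qq, cc, cp, cq, qp, qp', bq, one pp,
    one pp', one qq, one qq', tail cp, tail cp', tail cq, tail cq', tail qp, tail qp', tail qp2,
    tail qp3, tail3 bp, tail3 bq, mul_one, and_true]

theorem orderOf_eq_six {x : G} (h6 : x ^ 6 = 1) (h2 : x ^ 2 ≠ 1) (h3 : x ^ 3 ≠ 1) :
    orderOf x = 6 := by
  refine orderOf_eq_of_pow_and_pow_div_prime (by norm_num) h6 fun r hr hdvd => ?_
  have hle := Nat.le_of_dvd (by norm_num) hdvd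
  interval_cases r <;> first | exact h2 | exact h3 | (exfalso; revert hr hdvd; decide)

/-! ### The subgroup ⟨p, q, (pqc)³⟩ and cube-closed sets. -/

namespace IsSplitTriple

variable {p q c : G}

theorem word_identities (h : IsSplitTriple p q c) :
    (p * c) ^ 2 = p * (c * p * c) ∧ (p * c) ^ 3 = p * (c * p * c) * p * c ∧
    (p * q * c) ^ 2 = (p * (c * p * c)) * (q * (c * q * c)) ∧
    (p * q * c) ^ 3 = (p * (c * p * c) * p) * (q * (c * q * c) * q) * c ∧
    (p * q * c) ^ 3 * (p * q * c) ^ 3 = 1 ∧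
    (p * q * c) ^ 3 * p = p * (p * q * c) ^ 3 ∧
    p * (p * q * c) ^ 3 = p * (c * p * c) * (q * c) ^ 3 * (c * p * c * p) ∧
    p * q * (p * q * c) ^ 3 = p * (c * p * c) * q * (c * q * c) * c *
      (c * q * c * q * (c * p * c) * p) := by
  have cc := h.sq_conj
  have e1 : ∀ x : G, c * x = c * x * c * c := fun x => by rw [mul_assoc, cc, mul_one]
  have e2 : ∀ x : G, c * (c * x * c) = x * c := fun x => by
    rw [mul_assoc, ← mul_assoc, cc, one_mul]
  refine split_word_identities h.sq_left h.sq_left_conj h.sq_right h.sq_right_conj cc (e1 p) (e2 p)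
    (e1 q) (e2 q) h.comm h.symm.comm_conj.symm h.comm_conj ?_ ?_ ?_
  · calc c * q * c * (c * p * c) = c * q * (c * c) * p * c := by simp only [mul_assoc]
      _ = c * (q * p) * c := by rw [cc]; simp only [mul_assoc, one_mul]
      _ = c * p * (c * c) * q * c := by rw [h.comm, cc]; simp only [mul_assoc, one_mul]
      _ = _ := by simp only [mul_assoc]
  · rw [← mul_assoc, h.braid, mul_assoc]
  · rw [← mul_assoc, h.symm.braid, mul_assoc]

theorem left_mem (_ : IsSplitTriple p q c) : p ∈ Subgroup.closure {p, c * p * c} :=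
  Subgroup.subset_closure (by simp)

theorem conj_left_mem (_ : IsSplitTriple p q c) : c * p * c ∈ Subgroup.closure {p, c * p * c} :=
  Subgroup.subset_closure (by simp)

theorem orderOf_left (h : IsSplitTriple p q c) (hG : Nat.card G = 72) : orderOf (p * c) = 6 := by
  obtain ⟨h2, h3, -⟩ := h.word_identities
  refine orderOf_eq_six h.pow_left ?_ ?_
  · rw [h2]
    exact h.mul_conj_ne_one hG
  · rw [h3]
    have := h.mul_mul_conj_ne_one hG (x := p * (c * p * c) * p) (y := 1)
      (mul_mem (mul_mem h.left_mem h.conj_left_mem) h.left_mem) (one_mem _)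
    rwa [mul_one] at this

theorem orderOf_mul (h : IsSplitTriple p q c) (hG : Nat.card G = 72) :
    orderOf (p * q * c) = 6 := by
  obtain ⟨-, -, h2, h3, h4, -⟩ := h.word_identities
  refine orderOf_eq_six (by rw [← h4, ← pow_add]) ?_ ?_
  · rw [h2]
    intro h1
    exact h.mul_conj_ne_one hG (h.eq_one_of_mul_eq_one hG (mul_mem h.left_mem h.conj_left_mem)
      (mul_mem h.symm.left_mem h.symm.conj_left_mem) h1).1
  · rw [h3]
    exact h.mul_mul_conj_ne_one hG (mul_mem (mul_mem h.left_mem h.conj_left_mem) h.left_mem)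
      (mul_mem (mul_mem h.symm.left_mem h.symm.conj_left_mem) h.symm.left_mem)

theorem commute_cube (h : IsSplitTriple p q c) :
    Commute p ((p * q * c) ^ 3) ∧ Commute q ((p * q * c) ^ 3) := by
  refine ⟨h.word_identities.2.2.2.2.2.1.symm, ?_⟩
  have := h.symm.word_identities.2.2.2.2.2.1.symm
  rwa [h.comm] at this

theorem isElementaryAbelian8 (h : IsSplitTriple p q c) (hG : Nat.card G = 72) :
    IsElementaryAbelian8 (Subgroup.closure {p, q, (p * q * c) ^ 3}) := by
  obtain ⟨-, -, -, h3, h4, -⟩ := h.word_identities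
  have p1 : p ≠ 1 := by
    intro h1
    apply h.mul_conj_ne_one hG
    rw [h1, one_mul, mul_one, h.sq_conj]
  have q1 : q ≠ 1 := by
    intro h1
    apply h.symm.mul_conj_ne_one hG
    rw [h1, one_mul, mul_one, h.sq_conj]
  have hP : p * (c * p * c) * p ∈ Subgroup.closure {p, c * p * c} :=
    mul_mem (mul_mem h.left_mem h.conj_left_mem) h.left_mem
  have hQ : q * (c * q * c) * q ∈ Subgroup.closure {q, c * q * c} :=
    mul_mem (mul_mem h.symm.left_mem h.symm.conj_left_mem) h.symm.left_mem
  -- By `h3` the element (pqc)³ has a factor `c` in its normal form, so multiplying it by x and y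
  -- cannot give the identity.
  have key : ∀ x ∈ Subgroup.closure {p, c * p * c}, ∀ y ∈ Subgroup.closure {q, c * q * c},
      y * (p * (c * p * c) * p) = (p * (c * p * c) * p) * y → x * y * (p * q * c) ^ 3 ≠ 1 := by
    intro x hx y hy hc
    have : x * y * (p * q * c) ^ 3 =
        (x * (p * (c * p * c) * p)) * (y * (q * (c * q * c) * q)) * c := by
      rw [h3]
      calc _ = x * (y * (p * (c * p * c) * p)) * (q * (c * q * c) * q) * c := by
            simp only [mul_assoc]
        _ = _ := by rw [hc]; simp only [mul_assoc]
    rw [this]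
    exact h.mul_mul_conj_ne_one hG (mul_mem hx hP) (mul_mem hy hQ)
  have hq : q * (p * (c * p * c) * p) = (p * (c * p * c) * p) * q := by
    have e1 : Commute q p := h.comm
    have e2 : Commute q (c * p * c) := h.symm.comm_conj.symm
    exact ((e1.mul_right e2).mul_right e1).eq
  refine isElementaryAbelian8_closure h.sq_left h.sq_right h4 h.comm.symm h.commute_cube.1
    h.commute_cube.2 p1 q1 ?_ ?_ ?_ ?_ ?_
  · simpa using key 1 (one_mem _) 1 (one_mem _) (by simp)
  · intro h1
    exact p1 (h.eq_one_of_mul_eq_one hG h.left_mem h.symm.left_mem h1).1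
  · simpa using key p h.left_mem 1 (one_mem _) (by simp)
  · simpa using key 1 (one_mem _) q h.symm.left_mem hq
  · exact key p h.left_mem q h.symm.left_mem hq

/-- The element is the conjugate of (qc)³ by p·p^c, and qc has order 6. -/
theorem mul_cube_mem (h : IsSplitTriple p q c) (hG : Nat.card G = 72) {T : Set G}
    (hT : IsCubeClosed T) (hq : q ∈ T) (hc : c ∈ T) : p * (p * q * c) ^ 3 ∈ T := by
  have := hT.conj_mem _ (hT.cube_mem q hq c hc (h.symm.orderOf_left hG)) (p * (c * p * c))
  rw [h.word_identities.2.2.2.2.2.2.1]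
  convert this using 2
  rw [mul_inv_rev, inv_eq_of_mul_eq_one_left h.sq_left, inv_eq_of_mul_eq_one_left h.sq_left_conj]

/-- In order: a cube of (pq)c, conjugates of (qc)³ and (pc)³, and a conjugate of `c`. -/
theorem mem_of_isCubeClosed (h : IsSplitTriple p q c) (hG : Nat.card G = 72) {T : Set G}
    (hT : IsCubeClosed T) (hp : p ∈ T) (hq : q ∈ T) (hpq : p * q ∈ T) (hc : c ∈ T) :
    (p * q * c) ^ 3 ∈ T ∧ p * (p * q * c) ^ 3 ∈ T ∧ q * (p * q * c) ^ 3 ∈ T ∧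
      p * q * (p * q * c) ^ 3 ∈ T := by
  refine ⟨hT.cube_mem _ hpq _ hc (h.orderOf_mul hG), h.mul_cube_mem hG hT hq hc, ?_, ?_⟩
  · have := h.symm.mul_cube_mem hG hT hp hc
    rwa [h.comm] at this
  · have := hT.conj_mem _ hc (p * (c * p * c) * q * (c * q * c))
    rw [h.word_identities.2.2.2.2.2.2.2]
    convert this using 2
    simp only [mul_inv_rev, inv_eq_of_mul_eq_one_left h.sq_left,
      inv_eq_of_mul_eq_one_left h.sq_right, inv_eq_of_mul_eq_one_left h.sq_conj, mul_assoc]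

theorem closure_subset_of_isCubeClosed (h : IsSplitTriple p q c) (hG : Nat.card G = 72) {T : Set G}
    (hT : IsCubeClosed T) (hp : p ∈ T) (hq : q ∈ T) (hpq : p * q ∈ T) (hc : c ∈ T) {k : G}
    (hk : k ∈ Subgroup.closure {p, q, (p * q * c) ^ 3}) (hk1 : k ≠ 1) : k ∈ T := by
  obtain ⟨m1, m2, m3, m4⟩ := h.mem_of_isCubeClosed hG hT hp hq hpq hc
  rcases mem_closure_triple h.sq_left h.sq_right h.word_identities.2.2.2.2.1 h.comm.symm
    h.commute_cube.1 h.commute_cube.2 hk with rfl | rfl | rfl | rfl | rfl | rfl | rfl | rfl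
  · exact absurd rfl hk1
  all_goals assumption

end IsSplitTriple

theorem MajoranaRepresentation.false_of_isSplitTriple {p q c : G} {T : Set G} {V : Type*}
    [NormedAddCommGroup V] [InnerProductSpace ℝ V] (R : MajoranaRepresentation G T V)
    (h : IsSplitTriple p q c) (hG : Nat.card G = 72) (hp : p ∈ T) (hq : q ∈ T) (hpq : p * q ∈ T)
    (hc : c ∈ T) : False := by
  obtain ⟨m1, m2, m3, m4⟩ := h.mem_of_isCubeClosed hG R.isCubeClosed hp hq hpq hc
  exact R.not_pure_rank_three h.comm.symm hp hq m1 hpq m2 m3 m4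

/-! ### Presentations and the split triples they define. -/

theorem image_relators {H : Type*} [Group H] (f : G →* H) (a b c : G) (r₁ r₂ r₃ : ℕ) :
    f '' relators a b c r₁ r₂ r₃ = relators (f a) (f b) (f c) r₁ r₂ r₃ := by
  simp [relators, cj, Set.image_insert_eq]

theorem HasPresentation.relator_eq_one {a b c : G} {r₁ r₂ r₃ : ℕ}
    (h : HasPresentation a b c r₁ r₂ r₃) : ∀ x ∈ relators a b c r₁ r₂ r₃, x = 1 := by
  intro x hx
  have e := image_relators (FreeGroup.lift (![a, b, c] : Fin 3 → G)) (FreeGroup.of (0 : Fin 3))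
    (FreeGroup.of 1) (FreeGroup.of 2) r₁ r₂ r₃
  simp only [FreeGroup.lift_apply_of] at e
  change _ '' _ = relators a b c r₁ r₂ r₃ at e
  rw [← e] at hx
  obtain ⟨w, hw, rfl⟩ := hx
  have : w ∈ (FreeGroup.lift (![a, b, c] : Fin 3 → G)).ker := by
    rw [h.2]; exact Subgroup.subset_normalClosure hw
  exact this

/-- The group defined by the relators surjects onto `G`. Bounding its order by |G| makes the
surjection injective, so the relators generate the whole kernel. The bound is needed only for groups
in `Type`, where the quotient of `FreeGroup (Fin 3)` lives. -/
theorem hasPresentation_of_card_le {a b c : G} {r₁ r₂ r₃ : ℕ}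
    (hcl : Subgroup.closure {a, b, c} = ⊤) (hrel : ∀ x ∈ relators a b c r₁ r₂ r₃, x = 1)
    (hcard : ∀ (Q : Type) [Group Q] (x y z : Q), Subgroup.closure {x, y, z} = ⊤ →
      (∀ w ∈ relators x y z r₁ r₂ r₃, w = 1) → Finite Q ∧ Nat.card Q ≤ Nat.card G) :
    HasPresentation a b c r₁ r₂ r₃ := by
  refine ⟨hcl, ?_⟩
  set φ := FreeGroup.lift (![a, b, c] : Fin 3 → G)
  set N := Subgroup.normalClosure
    (relators (FreeGroup.of (0 : Fin 3)) (FreeGroup.of 1) (FreeGroup.of 2) r₁ r₂ r₃)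
  have hle : N ≤ φ.ker := by
    refine Subgroup.normalClosure_le_normal fun w hw => ?_
    have := Set.mem_image_of_mem φ hw
    rw [image_relators] at this
    simp only [φ, FreeGroup.lift_apply_of] at this
    exact hrel _ this
  refine le_antisymm (fun w hw => ?_) hle
  obtain ⟨hfin, hc⟩ := hcard (FreeGroup (Fin 3) ⧸ N) (QuotientGroup.mk' N (FreeGroup.of 0))
    (QuotientGroup.mk' N (FreeGroup.of 1)) (QuotientGroup.mk' N (FreeGroup.of 2)) (by
      have e := congrArg (Subgroup.map (QuotientGroup.mk' N)) (FreeGroup.closure_range_of (Fin 3))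
      rw [MonoidHom.map_closure, ← MonoidHom.range_eq_map, QuotientGroup.range_mk'] at e
      rw [← e]
      congr 1
      ext x
      simp [Fin.exists_fin_succ, eq_comm]) (by
      rw [← image_relators]
      rintro _ ⟨w, hw, rfl⟩
      exact (QuotientGroup.eq_one_iff w).2 (Subgroup.subset_normalClosure hw))
  have hsurj : Function.Surjective (QuotientGroup.lift N φ hle) := by
    rw [← MonoidHom.range_eq_top, ← top_le_iff, ← hcl, Subgroup.closure_le]
    rintro x (rfl | rfl | rfl)
    · exact ⟨QuotientGroup.mk' N (FreeGroup.of 0), by simp [φ]⟩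
    · exact ⟨QuotientGroup.mk' N (FreeGroup.of 1), by simp [φ]⟩
    · exact ⟨QuotientGroup.mk' N (FreeGroup.of 2), by simp [φ]⟩
  have hinj := (hsurj.bijective_of_nat_card_le hc).1
  rw [← QuotientGroup.eq_one_iff]
  apply hinj
  rw [map_one]
  exact hw

theorem commute_of_sq {x y : G} (hx : x * x = 1) (hy : y * y = 1) (hxy : (x * y) ^ 2 = 1) :
    y * x = x * y := by
  have := inv_eq_of_mul_eq_one_left ((pow_two (x * y)).symm.trans hxy)
  rwa [mul_inv_rev, inv_eq_of_mul_eq_one_left hx, inv_eq_of_mul_eq_one_left hy] at this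

theorem IsSplitTriple.of_pow_eq_one {p q c : G} (hcl : Subgroup.closure {p, q, c} = ⊤)
    (hp : p ^ 2 = 1) (hq : q ^ 2 = 1) (hc : c ^ 2 = 1) (hpq : (p * q) ^ 2 = 1)
    (hpc : (p * c) ^ 6 = 1) (hqc : (q * c) ^ 6 = 1) (hpqc : (p * cj q c) ^ 2 = 1) :
    IsSplitTriple p q c := by
  rw [pow_two] at hp hq hc
  have ic : c⁻¹ = c := inv_eq_of_mul_eq_one_left hc
  rw [cj, ic] at hpqc
  have hqq : c * q * c * (c * q * c) = 1 := by
    calc c * q * c * (c * q * c) = c * (q * (c * c) * q) * c := by simp only [mul_assoc]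
      _ = 1 := by rw [hc, mul_one, hq, mul_one, hc]
  exact ⟨hcl, hp, hq, hc, commute_of_sq hp hq hpq, commute_of_sq hp hqq hpqc, hpc, hqc⟩

section Relators

variable {a b c : G} (hcl : Subgroup.closure {a, b, c} = ⊤)

include hcl

theorem isSplitTriple_of_relators₁ (h : ∀ x ∈ relators a b c 2 6 6, x = 1) :
    IsSplitTriple a b c := by
  simp only [relators, Set.mem_insert_iff, Set.mem_singleton_iff, forall_eq_or_imp,
    forall_eq] at h
  obtain ⟨ha, hb, hc, hab, hac, hbc, habc, h1, h2, h3⟩ := h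
  exact .of_pow_eq_one hcl ha hb hc hab hac hbc h1

/-- With p = ab and q = b one has pq = a, so the relators (abc)⁶ and (ac)⁶ trade places and
(ab·b^c)² makes p commute with q^c. The third presentation is analogous with q = a. -/
theorem isSplitTriple_of_relators₂ (h : ∀ x ∈ relators a b c 6 2 6, x = 1) :
    IsSplitTriple (a * b) b c ∧ a * b * b = a := by
  simp only [relators, Set.mem_insert_iff, Set.mem_singleton_iff, forall_eq_or_imp,
    forall_eq] at h
  obtain ⟨ha, hb, hc, hab, hac, hbc, habc, h1, h2, h3⟩ := h
  have e : a * b * b = a := by rw [mul_assoc, ← pow_two, hb, mul_one]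
  refine ⟨.of_pow_eq_one ?_ hab hb hc (by rwa [e]) habc hbc h2, e⟩
  rw [← top_le_iff, ← hcl, Subgroup.closure_le]
  rintro x (rfl | rfl | rfl)
  · rw [← e]
    exact mul_mem (Subgroup.subset_closure (by simp [e])) (Subgroup.subset_closure (by simp))
  · exact Subgroup.subset_closure (by simp)
  · exact Subgroup.subset_closure (by simp)

theorem isSplitTriple_of_relators₃ (h : ∀ x ∈ relators a b c 6 6 2, x = 1) :
    IsSplitTriple (a * b) a c ∧ a * b * a = b := by
  simp only [relators, Set.mem_insert_iff, Set.mem_singleton_iff, forall_eq_or_imp,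
    forall_eq] at h
  obtain ⟨ha, hb, hc, hab, hac, hbc, habc, h1, h2, h3⟩ := h
  have e : a * b * a = b := by
    have := commute_of_sq ((pow_two a).symm.trans ha) ((pow_two b).symm.trans hb) hab
    rw [mul_assoc, this, ← mul_assoc, ← pow_two, ha, one_mul]
  refine ⟨.of_pow_eq_one ?_ hab ha hc (by rwa [e]) habc hac h3, e⟩
  rw [← top_le_iff, ← hcl, Subgroup.closure_le]
  rintro x (rfl | rfl | rfl)
  · exact Subgroup.subset_closure (by simp)
  · have := mul_mem (Subgroup.subset_closure (by simp : a * x ∈ ({a * x, a, c} : Set G)))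
      (Subgroup.subset_closure (by simp : a ∈ ({a * x, a, c} : Set G)))
    rwa [e] at this
  · exact Subgroup.subset_closure (by simp)

end Relators

end Groups

/-! ### The group 2 × S₃ × S₃ and its generating triples. -/

section Groups

theorem perm_three_triple {x y z : Equiv.Perm (Fin 3)} (hx : x * x = 1) (hy : y * y = 1)
    (hz : z * z = 1) (hxy : y * x = x * y) (hcl : Subgroup.closure {x, y, z} = ⊤) :
    Equiv.Perm.sign z = -1 ∧ (x = 1 ∧ Equiv.Perm.sign y = -1 ∨ y = 1 ∧ Equiv.Perm.sign x = -1 ∨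
      x * y = 1 ∧ Equiv.Perm.sign x = -1 ∧ Equiv.Perm.sign y = -1) := by
  have key : ∀ x y z : Equiv.Perm (Fin 3), x * x = 1 → y * y = 1 → z * z = 1 → y * x = x * y →
      (z * x = x * z ∧ z * y = y * z) ∨ Equiv.Perm.sign z = -1 ∧
      (x = 1 ∧ Equiv.Perm.sign y = -1 ∨ y = 1 ∧ Equiv.Perm.sign x = -1 ∨
        x * y = 1 ∧ Equiv.Perm.sign x = -1 ∧ Equiv.Perm.sign y = -1) := by decide
  -- If `z` commuted with `x` and `y`, the three elements would generate an abelian group, whereas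
  -- two transpositions of `S₃` fail to commute.
  refine (key x y z hx hy hz hxy).resolve_left fun ⟨hzx, hzy⟩ => ?_
  have hcomm : ∀ u ∈ ({x, y, z} : Set (Equiv.Perm (Fin 3))),
      ∀ v ∈ ({x, y, z} : Set (Equiv.Perm (Fin 3))), u * v = v * u := by
    rintro u (rfl | rfl | rfl) v (rfl | rfl | rfl) <;> first | rfl | assumption | (symm; assumption)
  have hle : Subgroup.closure {x, y, z} ≤ Subgroup.centralizer (Subgroup.closure {x, y, z}) := by
    rw [Subgroup.centralizer_closure, Subgroup.closure_le]
    exact fun u hu => Subgroup.mem_centralizer_iff.2 fun v hv => hcomm v hv u hu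
  rw [hcl] at hle
  have := Subgroup.mem_centralizer_iff.1 (hle (Subgroup.mem_top (Equiv.swap (0 : Fin 3) 1)))
    (Equiv.swap (1 : Fin 3) 2) (Subgroup.mem_top _)
  revert this
  decide

variable {G : Type*} [Group G]

theorem pow_six_eq_one (e : G ≃* Multiplicative (ZMod 2) × Equiv.Perm (Fin 3) × Equiv.Perm (Fin 3))
    (x : G) : x ^ 6 = 1 := by
  have h1 : ∀ u : Multiplicative (ZMod 2), u ^ 6 = 1 := by decide
  have h2 : ∀ u : Equiv.Perm (Fin 3), u ^ 6 = 1 := by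
    intro u
    have := pow_card_eq_one' (x := u)
    rwa [Nat.card_perm, Nat.card_fin] at this
  apply e.injective
  rw [map_pow, map_one]
  exact Prod.ext (h1 _) (Prod.ext (h2 _) (h2 _))

theorem natCard_eq (e : G ≃* Multiplicative (ZMod 2) × Equiv.Perm (Fin 3) × Equiv.Perm (Fin 3)) :
    Nat.card G = 72 := by
  rw [Nat.card_congr e.toEquiv, Nat.card_prod, Nat.card_prod, Nat.card_perm]
  simp [Nat.factorial]

theorem exists_relation (e : G ≃* Multiplicative (ZMod 2) × Equiv.Perm (Fin 3) × Equiv.Perm (Fin 3))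
    {a b c : G} (hcl : Subgroup.closure {a, b, c} = ⊤) (ha : a * a = 1) (hb : b * b = 1)
    (hc : c * c = 1) (hab : b * a = a * b) :
    Commute a (cj b c) ∨ Commute (a * b) (cj b c) ∨ Commute (a * b) (cj a c) := by
  set π₁ : G →* Equiv.Perm (Fin 3) :=
    (MonoidHom.fst _ _).comp ((MonoidHom.snd _ _).comp e.toMonoidHom)
  set π₂ : G →* Equiv.Perm (Fin 3) :=
    (MonoidHom.snd _ _).comp ((MonoidHom.snd _ _).comp e.toMonoidHom)
  -- A kernel is normal, so it contains y^c along with y. If each projection kills x or y, then x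
  -- and y^c commute in every coordinate, the factor of order 2 being abelian.
  have comm : ∀ x y : G, (π₁ x = 1 ∨ π₁ y = 1) → (π₂ x = 1 ∨ π₂ y = 1) →
      Commute x (cj y c) := by
    intro x y h1 h2
    have hm : ∀ f : G →* Equiv.Perm (Fin 3), (f x = 1 ∨ f y = 1) →
        f (x * cj y c) = f (cj y c * x) := by
      rintro f (h | h) <;> simp [cj, h]
    refine e.injective (Prod.ext ?_ (Prod.ext (hm π₁ h1) (hm π₂ h2)))
    rw [map_mul, map_mul, Prod.fst_mul, Prod.fst_mul, mul_comm]
  have triple : ∀ f : G →* Equiv.Perm (Fin 3), Function.Surjective f →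
      Equiv.Perm.sign (f c) = -1 ∧
        (f a = 1 ∧ Equiv.Perm.sign (f b) = -1 ∨ f b = 1 ∧ Equiv.Perm.sign (f a) = -1 ∨
          f a * f b = 1 ∧ Equiv.Perm.sign (f a) = -1 ∧ Equiv.Perm.sign (f b) = -1) := by
    intro f hf
    refine perm_three_triple ?_ ?_ ?_ ?_ ?_
    · rw [← map_mul, ha, map_one]
    · rw [← map_mul, hb, map_one]
    · rw [← map_mul, hc, map_one]
    · rw [← map_mul, hab, map_mul]
    · have := congrArg (Subgroup.map f) hcl
      rwa [MonoidHom.map_closure, Set.image_insert_eq, Set.image_pair,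
        Subgroup.map_top_of_surjective f hf] at this
  have hs₁ : Function.Surjective π₁ := fun u => ⟨e.symm (1, u, 1), by simp [π₁]⟩
  have hs₂ : Function.Surjective π₂ := fun u => ⟨e.symm (1, 1, u), by simp [π₂]⟩
  -- the two projections cannot kill the same one of `a`, `b`, `a b`
  have hne : ¬ (Equiv.Perm.sign (π₁ a) = Equiv.Perm.sign (π₂ a) ∧
      Equiv.Perm.sign (π₁ b) = Equiv.Perm.sign (π₂ b) ∧
      Equiv.Perm.sign (π₁ c) = Equiv.Perm.sign (π₂ c)) := by
    rintro ⟨h1, h2, h3⟩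
    have : Equiv.Perm.sign.comp π₁ = Equiv.Perm.sign.comp π₂ := by
      refine MonoidHom.eq_of_eqOn_dense hcl ?_
      rintro x (rfl | rfl | rfl) <;> assumption
    have h := DFunLike.congr_fun this (e.symm (1, Equiv.swap 0 1, 1))
    simp [π₁, π₂] at h
  obtain ⟨c1, t1⟩ := triple π₁ hs₁
  obtain ⟨c2, t2⟩ := triple π₂ hs₂
  have mul1 : ∀ f : G →* Equiv.Perm (Fin 3), f a * f b = 1 → f (a * b) = 1 := by
    intro f h; rw [map_mul, h]
  -- The rows are which of `a`, `b`, `ab` is killed by π₁, the columns by π₂. The diagonal is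
  -- excluded by `hne`; each unordered off-diagonal pair gives one relation.
  rcases t1 with ⟨h1, k1⟩ | ⟨h1, k1⟩ | ⟨h1, k1, k1'⟩ <;>
    rcases t2 with ⟨h2, k2⟩ | ⟨h2, k2⟩ | ⟨h2, k2, k2'⟩
  · exact absurd ⟨by rw [h1, h2], by rw [k1, k2], by rw [c1, c2]⟩ hne
  · exact Or.inl (comm _ _ (Or.inl h1) (Or.inr h2))
  · exact Or.inr (Or.inr (comm _ _ (Or.inr h1) (Or.inl (mul1 _ h2))))
  · exact Or.inl (comm _ _ (Or.inr h1) (Or.inl h2))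
  · exact absurd ⟨by rw [k1, k2], by rw [h1, h2], by rw [c1, c2]⟩ hne
  · exact Or.inr (Or.inl (comm _ _ (Or.inr h1) (Or.inl (mul1 _ h2))))
  · exact Or.inr (Or.inr (comm _ _ (Or.inl (mul1 _ h1)) (Or.inr h2)))
  · exact Or.inr (Or.inl (comm _ _ (Or.inl (mul1 _ h1)) (Or.inr h2)))
  · exact absurd ⟨by rw [k1, k2], by rw [k1', k2'], by rw [c1, c2]⟩ hne

theorem exists_hasPresentation
    (e : G ≃* Multiplicative (ZMod 2) × Equiv.Perm (Fin 3) × Equiv.Perm (Fin 3))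
    {a b c : G} (hcl : Subgroup.closure {a, b, c} = ⊤) (ha : a ^ 2 = 1) (hb : b ^ 2 = 1)
    (hc : c ^ 2 = 1) (hab : (a * b) ^ 2 = 1) :
    HasPresentation a b c 2 6 6 ∨ HasPresentation a b c 6 2 6 ∨ HasPresentation a b c 6 6 2 := by
  have h6 := pow_six_eq_one e
  have hsq : ∀ {x y : G}, x ^ 2 = 1 → y ^ 2 = 1 → Commute x (cj y c) → (x * cj y c) ^ 2 = 1 := by
    intro x y hx hy h
    rw [h.mul_pow, hx, one_mul, cj]
    have := conj_pow (i := 2) (a := c⁻¹) (b := y)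
    rw [inv_inv] at this
    rw [this, hy, mul_one, inv_mul_cancel]
  rcases exists_relation e hcl ((pow_two a).symm.trans ha) ((pow_two b).symm.trans hb)
    ((pow_two c).symm.trans hc) (commute_of_sq ((pow_two a).symm.trans ha)
      ((pow_two b).symm.trans hb) hab) with h | h | h
  · refine Or.inl (hasPresentation_of_card_le hcl ?_ fun Q _ x y z h1 h2 => ?_)
    · rintro x (rfl | rfl | rfl | rfl | rfl | rfl | rfl | rfl | rfl | rfl) <;>
        first | assumption | exact h6 _ | exact hsq ‹_› ‹_› h
    · rw [natCard_eq e]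
      exact (isSplitTriple_of_relators₁ h1 h2).card_le
  · refine Or.inr (Or.inl (hasPresentation_of_card_le hcl ?_ fun Q _ x y z h1 h2 => ?_))
    · rintro x (rfl | rfl | rfl | rfl | rfl | rfl | rfl | rfl | rfl | rfl) <;>
        first | assumption | exact h6 _ | exact hsq ‹_› ‹_› h
    · rw [natCard_eq e]
      exact (isSplitTriple_of_relators₂ h1 h2).1.card_le
  · refine Or.inr (Or.inr (hasPresentation_of_card_le hcl ?_ fun Q _ x y z h1 h2 => ?_))
    · rintro x (rfl | rfl | rfl | rfl | rfl | rfl | rfl | rfl | rfl | rfl) <;>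
        first | assumption | exact h6 _ | exact hsq ‹_› ‹_› h
    · rw [natCard_eq e]
      exact (isSplitTriple_of_relators₃ h1 h2).1.card_le

theorem closure_triple_eq {p q p' q' d : G} (h1 : p' ∈ Subgroup.closure {p, q, d})
    (h2 : q' ∈ Subgroup.closure {p, q, d}) (h3 : p ∈ Subgroup.closure {p', q', d})
    (h4 : q ∈ Subgroup.closure {p', q', d}) :
    Subgroup.closure {p', q', d} = Subgroup.closure {p, q, d} := by
  apply le_antisymm <;> rw [Subgroup.closure_le]
  · rintro x (rfl | rfl | rfl)
    exacts [h1, h2, Subgroup.subset_closure (by simp)]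
  · rintro x (rfl | rfl | rfl)
    exacts [h3, h4, Subgroup.subset_closure (by simp)]

/-- Each of the three presentations gives a split triple `p, q, c` with
`{p, q, p q} = {a, b, a b}`. -/
theorem exists_isSplitTriple {a b c : G} {K : Subgroup G}
    (hK : HasPresentation a b c 2 6 6 ∧ K = Subgroup.closure {a, b, (a * b * c) ^ 3} ∨
      HasPresentation a b c 6 2 6 ∧ K = Subgroup.closure {a, b, (a * c) ^ 3} ∨
      HasPresentation a b c 6 6 2 ∧ K = Subgroup.closure {a, b, (b * c) ^ 3}) :
    ∃ p q : G, IsSplitTriple p q c ∧ K = Subgroup.closure {p, q, (p * q * c) ^ 3} ∧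
      ∀ T : Set G, a ∈ T → b ∈ T → a * b ∈ T → p ∈ T ∧ q ∈ T ∧ p * q ∈ T := by
  have mem1 : ∀ x y z : G, x ∈ Subgroup.closure {x, y, z} := fun x y z =>
    Subgroup.subset_closure (by simp)
  have mem2 : ∀ x y z : G, y ∈ Subgroup.closure {x, y, z} := fun x y z =>
    Subgroup.subset_closure (by simp)
  rcases hK with ⟨h, rfl⟩ | ⟨h, rfl⟩ | ⟨h, rfl⟩
  · exact ⟨a, b, isSplitTriple_of_relators₁ h.1 h.relator_eq_one, rfl, fun T h1 h2 h3 =>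
      ⟨h1, h2, h3⟩⟩
  · obtain ⟨hs, e⟩ := isSplitTriple_of_relators₂ h.1 h.relator_eq_one
    refine ⟨a * b, b, hs, ?_, fun T h1 h2 h3 => ⟨h3, h2, by rwa [e]⟩⟩
    rw [e]
    refine closure_triple_eq ?_ (mem2 _ _ _) (mul_mem (mem1 _ _ _) (mem2 _ _ _)) (mem2 _ _ _)
    have := mul_mem (mem1 (a * b) b ((a * c) ^ 3)) (mem2 (a * b) b ((a * c) ^ 3))
    rwa [e] at this
  · obtain ⟨hs, e⟩ := isSplitTriple_of_relators₃ h.1 h.relator_eq_one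
    refine ⟨a * b, a, hs, ?_, fun T h1 h2 h3 => ⟨h3, h1, by rwa [e]⟩⟩
    rw [e]
    refine closure_triple_eq (mem2 _ _ _) ?_ (mul_mem (mem1 _ _ _) (mem2 _ _ _)) (mem1 _ _ _)
    have := mul_mem (mem1 (a * b) a ((b * c) ^ 3)) (mem2 (a * b) a ((b * c) ^ 3))
    rwa [e] at this

end Groups

end Majorana

theorem mainTheorem8 {G : Type*} [Group G] (a b c : G)
    (hG : Majorana.IsTrianglePoint a b c)
    (hiso : Nonempty (G ≃* Multiplicative (ZMod 2) × Equiv.Perm (Fin 3) × Equiv.Perm (Fin 3)))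
    (T : Set G) (haT : a ∈ T) (hbT : b ∈ T) (hcT : c ∈ T) (habT : a * b ∈ T) :
    (∀ (V : Type*) [NormedAddCommGroup V] [InnerProductSpace ℝ V],
      IsEmpty (Majorana.MajoranaRepresentation G T V)) ∧
    (Majorana.HasPresentation a b c 2 6 6 ∨ Majorana.HasPresentation a b c 6 2 6 ∨
      Majorana.HasPresentation a b c 6 6 2) ∧
    (∀ K : Subgroup G,
      (Majorana.HasPresentation a b c 2 6 6 ∧ K = Subgroup.closure {a, b, (a * b * c) ^ 3} ∨
        Majorana.HasPresentation a b c 6 2 6 ∧ K = Subgroup.closure {a, b, (a * c) ^ 3} ∨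
        Majorana.HasPresentation a b c 6 6 2 ∧ K = Subgroup.closure {a, b, (b * c) ^ 3}) →
      Majorana.IsElementaryAbelian8 K ∧
        (Majorana.IsCubeClosed T → ∀ k ∈ K, k ≠ 1 → k ∈ T)) := by
  obtain ⟨e⟩ := hiso
  have hcard := Majorana.natCard_eq e
  have hpres := Majorana.exists_hasPresentation e hG.closure_eq
    (orderOf_dvd_iff_pow_eq_one.1 hG.orderOf_a.dvd) (orderOf_dvd_iff_pow_eq_one.1 hG.orderOf_b.dvd)
    (orderOf_dvd_iff_pow_eq_one.1 hG.orderOf_c.dvd)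
    (orderOf_dvd_iff_pow_eq_one.1 hG.orderOf_ab.dvd)
  refine ⟨fun V _ _ => ⟨fun R => ?_⟩, hpres, fun K hK => ?_⟩
  -- Here K serves only to pass the presentation to `exists_isSplitTriple`.
  · obtain ⟨K, hK⟩ : ∃ K : Subgroup G,
        (Majorana.HasPresentation a b c 2 6 6 ∧ K = Subgroup.closure {a, b, (a * b * c) ^ 3} ∨
          Majorana.HasPresentation a b c 6 2 6 ∧ K = Subgroup.closure {a, b, (a * c) ^ 3} ∨
          Majorana.HasPresentation a b c 6 6 2 ∧ K = Subgroup.closure {a, b, (b * c) ^ 3}) := by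
      rcases hpres with h | h | h
      exacts [⟨_, Or.inl ⟨h, rfl⟩⟩, ⟨_, Or.inr (Or.inl ⟨h, rfl⟩)⟩, ⟨_, Or.inr (Or.inr ⟨h, rfl⟩)⟩]
    obtain ⟨p, q, hs, -, hT⟩ := Majorana.exists_isSplitTriple hK
    obtain ⟨h1, h2, h3⟩ := hT T haT hbT habT
    exact R.false_of_isSplitTriple hs hcard h1 h2 h3 hcT
  · obtain ⟨p, q, hs, rfl, hT⟩ := Majorana.exists_isSplitTriple hK
    obtain ⟨h1, h2, h3⟩ := hT T haT hbT habT
    exact ⟨hs.isElementaryAbelian8 hcard, fun hcc k hk hk1 =>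
      hs.closure_subset_of_isCubeClosed hcard hcc h1 h2 h3 hcT hk hk1⟩
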